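/- Let $G$ be a finite graph (loops and parallel edges are allowed; loops are never used in matchings) that is \emph{factorizable}, i.e. has a perfect matching. An edge of $G$ is \emph{allowed} if it lies in some perfect matching of $G$. A \emph{factor-component} of $G$ is an induced subgraph $G[V(H)]$, where $H$ is a connected component of the subgraph of $G$ determined by all the allowed edges; let $\mathcal{G}(G)$ be the set of factor-components of $G$. A set $X\subseteq V(G)$ is \emph{separating} if for every $H\in\mathcal{G}(G)$ either $V(H)\subseteq X$ or $V(H)\cap X=\emptyset$. A graph is \emph{factor-critical} if deleting any single vertex leaves a factorizable graph. For a graph $K$ and a subgraph $H$ of $K$, $K/H$ denotes the contraction of all edges of $K[V(H)]$. For $G_1,G_2\in\mathcal{G}(G)$ write $G_1\trianglelefteq G_2$ if there is a separating set $X\subseteq V(G)$ with $V(G_1)\cup V(G_2)\subseteq X$ such that $G[X]/G_1$ is factor-critical. Then $\trianglelefteq$ is a partial order on $\mathcal{G}(G)$, that is, it is reflexive, antisymmetric and transitive. -/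

import Mathlib

namespace Graph

/-- A matching of the (multi)graph `G`: a set of edges, none of which is a loop, no two of which
have a common vertex. -/
structure IsMatching {α β : Type*} (G : Graph α β) (M : Set β) : Prop where
  subset_edgeSet : M ⊆ G.edgeSet
  not_isLoopAt : ∀ e ∈ M, ∀ x, ¬ G.IsLoopAt e x
  disjoint : ∀ e ∈ M, ∀ f ∈ M, ∀ x, G.Inc e x → G.Inc f x → e = f

/-- A perfect matching: a matching that covers every vertex. (For a finite graph `G` this is the
same as a matching of cardinality `|V(G)| / 2`.) -/
structure IsPerfectMatching {α β : Type*} (G : Graph α β) (M : Set β) : Prop extends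
    IsMatching G M where
  exists_inc : ∀ x ∈ G.vertexSet, ∃ e ∈ M, G.Inc e x

/-- A graph is factorizable if it has a perfect matching. -/
def IsFactorizable {α β : Type*} (G : Graph α β) : Prop :=
  ∃ M, G.IsPerfectMatching M

/-- A graph is factor-critical if deleting any single vertex leaves a factorizable graph. -/
def IsFactorCritical {α β : Type*} (G : Graph α β) : Prop :=
  ∀ v ∈ G.vertexSet, (G.deleteVerts {v}).IsFactorizable

/-- The allowed edges: those contained in some perfect matching. -/
def allowedEdges {α β : Type*} (G : Graph α β) : Set β :=
  {e | ∃ M, G.IsPerfectMatching M ∧ e ∈ M}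

/-- The vertices that can be reached from `v` in `G`. -/
def reach {α β : Type*} (G : Graph α β) (v : α) : Set α :=
  {w | Relation.ReflTransGen G.Adj v w}

/-- The set of connected components of `G`, each of them a subgraph of `G`. -/
def connectedComponents {α β : Type*} (G : Graph α β) : Set (Graph α β) :=
  {H | ∃ v ∈ G.vertexSet, H = G.induce (G.reach v)}

/-- The elementary components of `G`: the connected components of the subgraph of `G` determined
by the allowed edges. (If `G` is factorizable, every vertex is an end of an allowed edge, so that
this subgraph has all the vertices of `G`.) -/
def elementaryComponents {α β : Type*} (G : Graph α β) : Set (Graph α β) :=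
  (G.restrict G.allowedEdges).connectedComponents

/-- The factor-components of `G`: the subgraphs `G[V(H)]` for the elementary components `H`. -/
def factorComponents {α β : Type*} (G : Graph α β) : Set (Graph α β) :=
  {K | ∃ H ∈ G.elementaryComponents, K = G.induce H.vertexSet}

/-- The contraction `G / F` of a set `F` of edges. Its vertices are the vertex sets of the
connected components of `(V(G), F)`; its edges are the edges of `G` outside `F`, each joining the
classes of its ends in `G` (so loops and parallel edges may arise). -/
def contractEdges {α β : Type*} (G : Graph α β) (F : Set β) : Graph (Set α) β :=
  (G.deleteEdges F).map (G.restrict F).reach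

/-- The contraction `G / X := G / E(G[X])` by a set `X` of vertices. -/
def contractVerts {α β : Type*} (G : Graph α β) (X : Set α) : Graph (Set α) β :=
  G.contractEdges (G.induce X).edgeSet

/-- A separating set: a set of vertices that contains or avoids each factor-component. -/
def IsSeparating {α β : Type*} (G : Graph α β) (X : Set α) : Prop :=
  X ⊆ G.vertexSet ∧
    ∀ H ∈ G.factorComponents, H.vertexSet ⊆ X ∨ H.vertexSet ∩ X = ∅

/-- `X` is a critical-inducing set for `G₁` to `G₂`: a separating set that contains the vertices
of both, such that `G[X] / G₁` is factor-critical. -/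
def IsCriticalInducing {α β : Type*} (G G₁ G₂ : Graph α β) (X : Set α) : Prop :=
  G.IsSeparating X ∧ G₁.vertexSet ∪ G₂.vertexSet ⊆ X ∧
    ((G.induce X).contractVerts G₁.vertexSet).IsFactorCritical

/-- The relation `G₁ ⊴ G₂` on the factor-components of `G`: there is a critical-inducing set
for `G₁` to `G₂`. -/
def Yields {α β : Type*} (G : Graph α β) (G₁ G₂ : G.factorComponents) : Prop :=
  ∃ X, G.IsCriticalInducing G₁ G₂ X

end Graph

/-! Loops are useless and parallel edges interchangeable, so the argument takes place in a simple
graph `Γ` with a perfect matching `f` of its vertex set `V`. A factor-component becomes a class `A`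
of vertices connected by allowed edges, and `G[X] / A` is factor-critical if and only if for each `v
∈ X \ A` there is `y ∈ A` such that `(X \ A) - v + y` is matchable
(`isFactorCritical_contractVerts_iff`).

Reflexivity holds with `X = A`, where the condition is empty. For transitivity, if `X` serves for
`A, B` and `Y` for `B, C`, then `X ∪ Y` serves for `A, C`: from `v ∈ Y \ X` a path alternating
between `f` and a matching of `(Y \ B) - v + y` runs through `Y \ X` until it enters `X`, where the
condition on `X` and `A` takes over (`IsCriticalOver.trans`).

For antisymmetry let `A ≠ B`, take `v ∈ B` and a matching `g` of `(X \ A) - v + y`. The edge from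
`y` to `g y` leaves `A`, so it is not allowed, and Tutte's theorem yields a barrier `S` containing
both ends, with factor-critical odd components `C s`, one for each `s ∈ S`
(`IsPairing.exists_isCriticalBarrier`). Counting gives `s ∈ S` outside `A` with `v ∈ C s`. Write `s
→ t` if `C s` has an edge to `t`. A set of barrier vertices closed under arcs, taken with its
components, is a union of factor-components; if it meets `X` it meets `A`, and if it meets `Y` it
meets `B`, again by counting (`exists_mem_of_isCriticalOver`). Hence `s` and `y` can be reached from
each other. By Hall's theorem an arc in a strong component comes from an allowed edge
(`allowedAdj_of_arc`), and a parity argument then puts `s` into `A`, a contradiction. -/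

/-! ### Pairings: perfect matchings of induced subgraphs as involutions. -/

namespace SimpleGraph

variable {α : Type*} {Γ : SimpleGraph α} {f : α → α} {S T : Finset α}

/-- `f` maps each vertex of `S` to its partner in a perfect matching of `Γ[S]`. -/
def IsPairing (Γ : SimpleGraph α) (f : α → α) (S : Finset α) : Prop :=
  ∀ x ∈ S, f x ∈ S ∧ Γ.Adj x (f x) ∧ f (f x) = x

/-- The subgraph of `Γ` induced by `S` has a perfect matching. -/
def Matchable (Γ : SimpleGraph α) (S : Finset α) : Prop := ∃ f, Γ.IsPairing f S

lemma IsPairing.matchable (h : Γ.IsPairing f S) : Γ.Matchable S := ⟨f, h⟩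

lemma IsPairing.injOn (h : Γ.IsPairing f S) : Set.InjOn f S := fun x hx y hy e ↦ by
  rw [← (h x hx).2.2, ← (h y hy).2.2, e]

lemma IsPairing.mono (h : Γ.IsPairing f S) (hTS : T ⊆ S) (hT : ∀ x ∈ T, f x ∈ T) :
    Γ.IsPairing f T := fun x hx ↦ ⟨hT x hx, (h x (hTS hx)).2⟩

lemma IsPairing.even_card (h : Γ.IsPairing f S) : Even S.card := by
  -- `f` is an involution of `S` without fixed points, so the terms cancel in pairs modulo 2.
  have key : ∑ x ∈ S, (1 : ZMod 2) = 0 := by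
    refine Finset.sum_involution (fun x _ ↦ f x) (fun _ _ ↦ by decide) ?_ ?_ ?_
    · intro x hx _ e
      exact (h x hx).2.1.ne e.symm
    · exact fun x hx ↦ (h x hx).1
    · exact fun x hx ↦ (h x hx).2.2
  rw [Finset.sum_const, nsmul_eq_mul, mul_one] at key
  exact (ZMod.natCast_eq_zero_iff_even).1 key

lemma Matchable.even_card (h : Γ.Matchable S) : Even S.card := h.elim fun _ h ↦ h.even_card

variable [DecidableEq α]

lemma Matchable.union (hS : Γ.Matchable S) (hT : Γ.Matchable T) (hST : Disjoint S T) :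
    Γ.Matchable (S ∪ T) := by
  obtain ⟨f, hf⟩ := hS
  obtain ⟨g, hg⟩ := hT
  refine ⟨fun x ↦ if x ∈ S then f x else g x, fun x hx ↦ ?_⟩
  rw [Finset.disjoint_left] at hST
  by_cases hxS : x ∈ S
  · have := hf x hxS
    simp_all
  · have hxT : x ∈ T := by simpa [hxS] using hx
    have h1 := hg x hxT
    have : g x ∉ S := fun h ↦ hST h h1.1
    simp_all

lemma Matchable.biUnion {ι : Type*} {I : Finset ι} {C : ι → Finset α}
    (hC : ∀ i ∈ I, Γ.Matchable (C i)) (hd : (I : Set ι).PairwiseDisjoint C) :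
    Γ.Matchable (I.biUnion C) := by
  classical
  induction I using Finset.induction_on with
  | empty => exact ⟨id, by simp [IsPairing]⟩
  | insert a I ha ih =>
    rw [Finset.biUnion_insert]
    refine (hC a (by simp)).union (ih (fun i hi ↦ hC i (by simp [hi])) (hd.subset (by simp))) ?_
    rw [Finset.disjoint_biUnion_right]
    intro i hi
    exact hd (by simp) (by simp [hi]) (by rintro rfl; exact ha hi)

lemma matchable_pair {x y : α} (h : Γ.Adj x y) : Γ.Matchable {x, y} := by
  refine ⟨fun z ↦ if z = x then y else x, ?_⟩
  have := h.ne
  have := h.symm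
  intro z hz
  simp only [Finset.mem_insert, Finset.mem_singleton] at hz
  rcases hz with rfl | rfl <;> simp_all

/-- Serves to match a factor-critical set together with one vertex outside it. -/
lemma Matchable.of_erase {c u : α} (h : Γ.Matchable (S.erase c)) (hc : c ∈ S) (hu : u ∉ S)
    (hcu : Γ.Adj c u) : Γ.Matchable (insert u S) := by
  have := h.union (matchable_pair hcu) (by
    simp only [Finset.disjoint_left, Finset.mem_erase, Finset.mem_insert, Finset.mem_singleton]
    rintro a ⟨h1, h2⟩ (rfl | rfl)
    exacts [h1 rfl, hu h2])
  convert this using 1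
  grind

/-- The vertices of an odd set that are not matched inside the set are matched to `T`; hence the
number of disjoint odd sets is at most the number of vertices in `T`. -/
lemma IsPairing.card_le_of_odd {ι : Type*} {I : Finset ι} {C : ι → Finset α} {Z : Finset α}
    (hf : Γ.IsPairing f Z) (hd : (I : Set ι).PairwiseDisjoint C)
    (hodd : ∀ i ∈ I, Odd (C i ∩ Z).card)
    (hT : ∀ i ∈ I, ∀ c ∈ C i ∩ Z, f c ∈ C i ∨ f c ∈ T) : I.card ≤ (T ∩ Z).card := by
  -- Otherwise `f` would pair off the odd set `C i ∩ Z`.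
  have : ∀ i ∈ I, ∃ c ∈ C i ∩ Z, f c ∉ C i := by
    intro i hi
    by_contra! hcon
    refine Nat.not_even_iff_odd.2 (hodd i hi) (hf.mono Finset.inter_subset_right ?_).even_card
    exact fun x hx ↦ Finset.mem_inter.2 ⟨hcon x hx, (hf x (Finset.mem_inter.1 hx).2).1⟩
  obtain rfl | ⟨i₀, hi₀⟩ := I.eq_empty_or_nonempty
  · simp
  have : Nonempty α := (this i₀ hi₀).nonempty
  choose! c hc hfc using ‹∀ i ∈ I, ∃ c ∈ C i ∩ Z, f c ∉ C i›
  refine Finset.card_le_card_of_injOn (fun i ↦ f (c i)) ?_ ?_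
  · intro i hi
    have h1 := hc i hi
    have h2 := hfc i hi
    have h3 := hT i hi _ h1
    have h4 := (hf _ (Finset.mem_inter.1 h1).2).1
    simp only [Finset.coe_inter, Set.mem_inter_iff, Finset.mem_coe]
    tauto
  · intro i hi j hj hij
    by_contra hne
    have h1 := Finset.mem_inter.1 (hc i hi)
    have h2 := Finset.mem_inter.1 (hc j hj)
    have h3 := hf.injOn h1.2 h2.2 hij
    exact Finset.disjoint_left.1 (hd hi hj hne) h1.1 (h3 ▸ h2.1)

/-- Moving along the path of edges from the pairing `f` of `D` and from the matching `g`, which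
covers `D` except for `v`, until it leaves `D`. -/
lemma IsPairing.exists_matchable_insert_erase {g : α → α} {D : Finset α} {v : α}
    (hf : Γ.IsPairing f D) (hv : v ∈ D)
    (hg : ∀ x ∈ D, x ≠ v → Γ.Adj x (g x) ∧ g (g x) = x ∧ g x ≠ v) :
    ∃ x ∈ D, x ≠ v ∧ g x ∉ D ∧ Γ.Matchable (insert (g x) (D.erase v)) := by
  induction hn : D.card using Nat.strong_induction_on generalizing D v with
  | _ n ih =>
    obtain ⟨h1, h2, h3⟩ := hf v hv
    obtain ⟨h4, h5, h6⟩ := hg (f v) h1 h2.ne'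
    have hD : Γ.IsPairing f ((D.erase v).erase (f v)) := by
      refine hf.mono (by grind) fun x hx ↦ ?_
      have hx' : x ∈ D := by grind
      have := hf x hx'
      simp only [Finset.mem_erase] at hx ⊢
      grind
    -- The path begins `v`, `f v`, `g (f v)`. If it is still in `D`, it continues from `g (f v)` in
    -- `D` without `v` and `f v`, and the edge from `f v` to `g (f v)` is added at the end.
    by_cases hw : g (f v) ∈ D
    · obtain ⟨x, hx, hxw, hgx, hm⟩ := ih ((D.erase v).erase (f v)).card (by
        rw [← hn]
        exact Finset.card_lt_card (Finset.ssubset_iff_subset_ne.2 ⟨by grind, by grind⟩)) hD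
        (v := g (f v)) (by grind [h4.ne]) (by grind) rfl
      refine ⟨x, by grind, by grind, by grind, ?_⟩
      have := hm.union (matchable_pair h4) (by
        rw [Finset.disjoint_left]
        grind [h4.ne])
      convert this using 1
      grind [h4.ne]
    · refine ⟨f v, h1, h2.ne', hw, ?_⟩
      have := hD.matchable.union (matchable_pair h4) (by
        rw [Finset.disjoint_left]
        grind)
      convert this using 1
      grind [h2.ne]

end SimpleGraph

/-! ### Tutte's theorem and barriers with factor-critical odd components. -/

namespace SimpleGraph

variable {α : Type*} {Γ : SimpleGraph α}

/-- `F` is a family of disjoint odd sets in `W \ S` such that no edge of `Γ[W] - S` leaves a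
member of `F`. -/
structure IsOddFamily (Γ : SimpleGraph α) (W S : Finset α) (F : Finset (Finset α)) : Prop where
  subset : S ⊆ W
  subset_of_mem : ∀ C ∈ F, C ⊆ W
  notMem : ∀ C ∈ F, ∀ c ∈ C, c ∉ S
  odd : ∀ C ∈ F, Odd C.card
  adj : ∀ C ∈ F, ∀ c ∈ C, ∀ w ∈ W, Γ.Adj c w → w ∈ S ∨ w ∈ C
  eq_of_mem : ∀ C ∈ F, ∀ D ∈ F, ∀ c, c ∈ C → c ∈ D → C = D

/-- The nontrivial direction of Tutte's theorem, for induced subgraphs. -/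
lemma exists_isOddFamily_of_not_matchable {W : Finset α} (h : ¬ Γ.Matchable W) :
    ∃ S F, Γ.IsOddFamily W S F ∧ S.card < F.card := by
  classical
  let K := Γ.induce (W : Set α)
  have hK : ¬ ∃ M : Subgraph K, M.IsPerfectMatching := by
    rintro ⟨M, hM⟩
    rw [Subgraph.isPerfectMatching_iff] at hM
    choose g hg hgu using hM
    refine h ⟨fun x ↦ if hx : x ∈ W then (g ⟨x, hx⟩ : α) else x, fun x hx ↦ ?_⟩
    have h1 := (hg ⟨x, hx⟩)
    have h2 : g (g ⟨x, hx⟩) = ⟨x, hx⟩ := (hgu _ _ h1.symm).symm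
    have h3 : Γ.Adj x (g ⟨x, hx⟩) := h1.adj_sub
    have h4 : (g ⟨x, hx⟩ : α) ∈ W := (g ⟨x, hx⟩).2
    simp only [hx, dif_pos, h4, h3, Subtype.coe_eta, h2, and_self]
  rw [tutte] at hK
  push Not at hK
  obtain ⟨u, hu⟩ := hK
  let L := ((⊤ : K.Subgraph).deleteVerts u).coe
  have hfin : Finite ((⊤ : K.Subgraph).deleteVerts u).verts := inferInstance
  let φ : ((⊤ : K.Subgraph).deleteVerts u).verts → α := fun x ↦ x.1.1
  have hφ : Function.Injective φ := fun x y hxy ↦ Subtype.ext (Subtype.ext hxy)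
  let ψ : L.ConnectedComponent → Finset α := fun c ↦ (Set.toFinite (φ '' c.supp)).toFinset
  have hψ : ∀ c x, x ∈ ψ c ↔ ∃ y, L.connectedComponentMk y = c ∧ φ y = x := by
    intro c x
    simp [ψ]
  have hψinj : Function.Injective ψ := by
    intro c d hcd
    induction c using ConnectedComponent.ind with | _ v =>
    have : φ v ∈ ψ (L.connectedComponentMk v) := (hψ _ _).2 ⟨v, rfl, rfl⟩
    rw [hcd, hψ] at this
    obtain ⟨y, hy, hyv⟩ := this
    rw [← hy, hφ hyv]
  have hmem : ∀ y, φ y ∈ W ∧ ∀ h : φ y ∈ W, (⟨φ y, h⟩ : (W : Set α)) ∉ u := fun y ↦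
    ⟨y.1.2, fun h ↦ by have := y.2; simpa using this⟩
  refine ⟨(Set.toFinite (Subtype.val '' u)).toFinset,
    (Set.toFinite (ψ '' L.oddComponents)).toFinset, ?_, ?_⟩
  · constructor
    · intro x hx
      simp only [Set.Finite.mem_toFinset] at hx
      obtain ⟨y, _, rfl⟩ := hx
      exact y.2
    · simp only [Set.Finite.mem_toFinset]
      rintro _ ⟨c, hc, rfl⟩ x hx
      obtain ⟨y, -, rfl⟩ := (hψ _ _).1 hx
      exact (hmem y).1
    · simp only [Set.Finite.mem_toFinset]
      rintro _ ⟨c, hc, rfl⟩ x hx ⟨z, hz, hzx⟩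
      obtain ⟨y, -, rfl⟩ := (hψ _ _).1 hx
      refine (hmem y).2 (hmem y).1 ?_
      convert hz using 1
      exact Subtype.ext hzx.symm
    · simp only [Set.Finite.mem_toFinset]
      rintro _ ⟨c, hc, rfl⟩
      rw [← Set.ncard_eq_toFinset_card (φ '' c.supp), Set.ncard_image_of_injective _ hφ]
      exact hc
    · simp only [Set.Finite.mem_toFinset]
      rintro _ ⟨c, hc, rfl⟩ x hx w hw hxw
      obtain ⟨y, hy, rfl⟩ := (hψ _ _).1 hx
      by_cases hwu : (⟨w, hw⟩ : (W : Set α)) ∈ u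
      · exact Or.inl ⟨_, hwu, rfl⟩
      · right
        have hw' : (⟨w, hw⟩ : (W : Set α)) ∈ ((⊤ : K.Subgraph).deleteVerts u).verts := by
          simpa using hwu
        refine (hψ _ _).2 ⟨⟨⟨w, hw⟩, hw'⟩, ?_, rfl⟩
        rw [← hy]
        refine (ConnectedComponent.connectedComponentMk_eq_of_adj ?_).symm
        have h1 := y.2
        have : K.Adj y.1 ⟨w, hw⟩ := hxw
        simp_all [L]
    · simp only [Set.Finite.mem_toFinset]
      rintro _ ⟨c, hc, rfl⟩ _ ⟨d, hd, rfl⟩ x hx hx'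
      obtain ⟨y, hy, rfl⟩ := (hψ _ _).1 hx
      obtain ⟨z, hz, hzy⟩ := (hψ _ _).1 hx'
      rw [← hy, ← hz, hφ hzy]
  · rw [← Set.ncard_eq_toFinset_card (Subtype.val '' u),
      ← Set.ncard_eq_toFinset_card (ψ '' L.oddComponents),
      Set.ncard_image_of_injective _ hψinj, Set.ncard_image_of_injective _ Subtype.val_injective]
    exact hu

/-- If `W` is even, then by parity the odd family has at least two more members than `S`. -/
lemma exists_isOddFamily_of_even {W : Finset α} (hW : Even W.card) (h : ¬ Γ.Matchable W) :
    ∃ S F, Γ.IsOddFamily W S F ∧ S.card + 2 ≤ F.card := by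
  classical
  obtain ⟨T, E, hE, hTE⟩ := exists_isOddFamily_of_not_matchable h
  refine ⟨T, ?_⟩
  rcases Nat.lt_or_ge (T.card + 1) E.card with h | h
  · exact ⟨E, hE, h⟩
  -- The surplus is now exactly one, so the rest `R` of `W \ T` is odd and can join the family;
  -- members need not be connected.
  let R := (W \ T) \ E.biUnion id
  have hRmem : ∀ x, x ∈ R ↔ (x ∈ W ∧ x ∉ T) ∧ ∀ D ∈ E, x ∉ D := by
    intro x; simp [R]
  have hdisj : (E : Set (Finset α)).PairwiseDisjoint id := fun D hD D' hD' hne ↦ by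
    refine Finset.disjoint_left.2 fun x hx hx' ↦ hne (hE.eq_of_mem D hD D' hD' x hx hx')
  have hsum : (E.biUnion id).card % 2 = E.card % 2 := by
    rw [Finset.card_biUnion hdisj, Finset.sum_nat_mod,
      Finset.sum_congr rfl (g := fun _ ↦ 1) fun D hD ↦ by exact Nat.odd_iff.1 (hE.odd D hD)]
    simp
  have hsub : E.biUnion id ⊆ W \ T := by
    intro x hx
    simp only [Finset.mem_biUnion, id] at hx
    obtain ⟨D, hD, hx⟩ := hx
    exact Finset.mem_sdiff.2 ⟨hE.subset_of_mem D hD hx, hE.notMem D hD x hx⟩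
  have h1 : R.card = (W \ T).card - (E.biUnion id).card :=
    Finset.card_sdiff_of_subset hsub
  have h2 := Finset.card_le_card hsub
  have h3 : (W \ T).card = W.card - T.card :=
    Finset.card_sdiff_of_subset hE.subset
  have h4 := Finset.card_le_card hE.subset
  have hRodd : Odd R.card := by
    rw [Nat.odd_iff]
    rw [Nat.even_iff] at hW
    omega
  have hRne : ∃ x, x ∈ R := by
    obtain ⟨x, hx⟩ := Finset.card_pos.1 hRodd.pos
    exact ⟨x, hx⟩
  have hRE : R ∉ E := fun hR ↦ hRne.elim fun x hx ↦ ((hRmem x).1 hx).2 R hR hx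
  refine ⟨insert R E, ?_, by rw [Finset.card_insert_of_notMem hRE]; omega⟩
  constructor
  · exact hE.subset
  · simp only [Finset.mem_insert, forall_eq_or_imp]
    exact ⟨fun x hx ↦ ((hRmem x).1 hx).1.1, hE.subset_of_mem⟩
  · simp only [Finset.mem_insert, forall_eq_or_imp]
    exact ⟨fun x hx ↦ ((hRmem x).1 hx).1.2, hE.notMem⟩
  · simp only [Finset.mem_insert, forall_eq_or_imp]
    exact ⟨hRodd, hE.odd⟩
  · simp only [Finset.mem_insert, forall_eq_or_imp]
    refine ⟨fun x hx w hw hxw ↦ ?_, hE.adj⟩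
    rw [hRmem] at hx ⊢
    by_contra! hcon
    obtain ⟨D, hD, hwD⟩ := hcon.2 ⟨hw, hcon.1⟩
    have := hE.adj D hD w hwD x hx.1.1 hxw.symm
    exact this.elim hx.1.2 (hx.2 D hD)
  · simp only [Finset.mem_insert, forall_eq_or_imp]
    refine ⟨⟨fun _ _ _ ↦ trivial, fun D hD x hx hxD ↦ absurd hxD (((hRmem x).1 hx).2 D hD)⟩,
      fun D hD ↦ ⟨fun x hxD hx ↦ absurd hxD (((hRmem x).1 hx).2 D hD), hE.eq_of_mem D hD⟩⟩

/-- An odd family may be refined to one of factor-critical sets, without lowering the surplus. -/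
lemma exists_isOddFamily_matchable_erase [DecidableEq α] {W S : Finset α}
    {F : Finset (Finset α)} {d : ℕ} (hF : Γ.IsOddFamily W S F)
    (hd : S.card + d ≤ F.card) :
    ∃ S' F', S ⊆ S' ∧ Γ.IsOddFamily W S' F' ∧ S'.card + d ≤ F'.card ∧
      ∀ C ∈ F', ∀ c ∈ C, Γ.Matchable (C.erase c) := by
  by_cases hcrit : ∀ C ∈ F, ∀ c ∈ C, Γ.Matchable (C.erase c)
  · exact ⟨S, F, subset_rfl, hF, hd, hcrit⟩
  push Not at hcrit
  obtain ⟨C, hC, c, hc, hm⟩ := hcrit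
  -- `C` is replaced by `E`, and `S` grows by `T` and `c`. The surplus of two in `E` pays for the
  -- loss of `C` and for `c`; the process stops because `S` grows inside `W`.
  obtain ⟨T, E, hE, hTE⟩ := exists_isOddFamily_of_even (by
    have := hF.odd C hC
    rw [Nat.odd_iff] at this
    rw [Nat.even_iff, Finset.card_erase_of_mem hc]
    omega) hm
  have hTC : T ⊆ C := hE.subset.trans (Finset.erase_subset _ _)
  have hEC : ∀ D ∈ E, D ⊆ C := fun D hD ↦ (hE.subset_of_mem D hD).trans (Finset.erase_subset _ _)
  have hEne : ∀ D ∈ E, ∃ x, x ∈ D := fun D hD ↦ Finset.card_pos.1 (hE.odd D hD).pos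
  have hTc : c ∉ T := fun h ↦ by simpa using hE.subset h
  have hEc : ∀ D ∈ E, c ∉ D := fun D hD h ↦ by simpa using hE.subset_of_mem D hD h
  have hne : ∀ D ∈ F.erase C, ∀ x ∈ D, x ∉ C := fun D hD x hx hxC ↦ by
    rw [Finset.mem_erase] at hD
    exact hD.1 (hF.eq_of_mem D hD.2 C hC x hx hxC)
  have hST : Disjoint S (insert c T) := by
    rw [Finset.disjoint_left]
    intro x hx hx'
    exact hF.notMem C hC x (by grind) hx
  have hFE : Disjoint (F.erase C) E := by
    rw [Finset.disjoint_left]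
    intro D hD hD'
    obtain ⟨x, hx⟩ := hEne D hD'
    exact hne D hD x hx (hEC D hD' hx)
  have hcard : (S ∪ insert c T).card = S.card + (T.card + 1) := by
    rw [Finset.card_union_of_disjoint hST, Finset.card_insert_of_notMem hTc]
  have hle : (S ∪ insert c T).card ≤ W.card := by
    refine Finset.card_le_card (Finset.union_subset hF.subset ?_)
    refine Finset.insert_subset (hF.subset_of_mem C hC hc) (hTC.trans (hF.subset_of_mem C hC))
  have hnew : Γ.IsOddFamily W (S ∪ insert c T) (F.erase C ∪ E) := by
    have hFm : ∀ D ∈ F.erase C, D ∈ F := fun D hD ↦ Finset.mem_of_mem_erase hD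
    constructor
    · refine Finset.union_subset hF.subset ?_
      refine Finset.insert_subset (hF.subset_of_mem C hC hc) (hTC.trans (hF.subset_of_mem C hC))
    · intro D hD
      rcases Finset.mem_union.1 hD with hD | hD
      · exact hF.subset_of_mem D (hFm D hD)
      · exact (hEC D hD).trans (hF.subset_of_mem C hC)
    · intro D hD x hx
      rcases Finset.mem_union.1 hD with hD | hD
      · have h1 := hF.notMem D (hFm D hD) x hx
        have h2 := hne D hD x hx
        grind
      · have h1 := hF.notMem C hC x (hEC D hD hx)
        have h2 := hE.notMem D hD x hx
        have h3 := hEc D hD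
        grind
    · intro D hD
      rcases Finset.mem_union.1 hD with hD | hD
      · exact hF.odd D (hFm D hD)
      · exact hE.odd D hD
    · intro D hD x hx w hw hxw
      rcases Finset.mem_union.1 hD with hD | hD
      · have := hF.adj D (hFm D hD) x hx w hw hxw
        grind
      · have h1 := hF.adj C hC x (hEC D hD hx) w hw hxw
        by_cases hwc : w = c
        · grind
        have h2 := hE.adj D hD x hx w
        grind
    · intro D hD D' hD' x hx hx'
      rcases Finset.mem_union.1 hD with hD | hD <;> rcases Finset.mem_union.1 hD' with hD' | hD'
      · exact hF.eq_of_mem D (hFm D hD) D' (hFm D' hD') x hx hx'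
      · exact absurd (hEC D' hD' hx') (hne D hD x hx)
      · exact absurd (hEC D hD hx) (hne D' hD' x hx')
      · exact hE.eq_of_mem D hD D' hD' x hx hx'
  have hdec : W.card - (S ∪ insert c T).card < W.card - S.card := by omega
  obtain ⟨S', F', hS', h⟩ := exists_isOddFamily_matchable_erase (d := d) hnew (by
    rw [Finset.card_union_of_disjoint hFE, Finset.card_erase_of_mem hC, hcard]
    omega)
  exact ⟨S', F', Finset.subset_union_left.trans hS', h⟩
termination_by W.card - S.card
decreasing_by exact hdec

/-- A barrier `S` of `Γ[V]` whose odd components are factor-critical: `C s` is the odd component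
that is joined to `s ∈ S` by an edge of the perfect matching `f`. -/
structure IsCriticalBarrier [DecidableEq α] (Γ : SimpleGraph α) (f : α → α) (V S : Finset α)
    (C : α → Finset α) : Prop where
  subset : S ⊆ V
  part_subset : ∀ s ∈ S, C s ⊆ V
  notMem : ∀ s ∈ S, ∀ c ∈ C s, c ∉ S
  partner_mem : ∀ s ∈ S, f s ∈ C s
  matchable : ∀ s ∈ S, ∀ c ∈ C s, Γ.Matchable ((C s).erase c)
  adj : ∀ s ∈ S, ∀ c ∈ C s, ∀ w ∈ V, Γ.Adj c w → w ∈ S ∨ w ∈ C s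
  eq_of_mem : ∀ s ∈ S, ∀ t ∈ S, ∀ c, c ∈ C s → c ∈ C t → s = t

/-- An odd family of `V - x - y` has surplus at least two, which is used up when `x` and `y` join
the barrier. Since `f` matches `V`, the number of odd sets cannot exceed `S.card`, so `f` gives a
bijection between `S` and the odd sets. -/
lemma IsPairing.exists_isCriticalBarrier [DecidableEq α] {f : α → α} {V : Finset α} {x y : α}
    (hf : Γ.IsPairing f V) (hx : x ∈ V) (hy : y ∈ V) (hxy : x ≠ y)
    (h : ¬ Γ.Matchable ((V.erase x).erase y)) :
    ∃ S C, x ∈ S ∧ y ∈ S ∧ Γ.IsCriticalBarrier f V S C := by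
  obtain ⟨T, E, hE, hTE⟩ := exists_isOddFamily_of_even (by
    have := hf.even_card
    rw [Nat.even_iff] at this ⊢
    rw [Finset.card_erase_of_mem (by grind), Finset.card_erase_of_mem hx]
    have : 1 < V.card := Finset.one_lt_card.2 ⟨x, hx, y, hy, hxy⟩
    omega) h
  have hE' : Γ.IsOddFamily V (insert x (insert y T)) E := by
    constructor
    · have := hE.subset
      grind
    · have := hE.subset_of_mem
      grind
    · have h1 := hE.notMem
      have h2 := hE.subset_of_mem
      intro D hD c hc
      have := h2 D hD hc
      have := h1 D hD c hc
      grind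
    · exact hE.odd
    · intro D hD c hc w hw hcw
      have := hE.adj D hD c hc w
      grind
    · exact hE.eq_of_mem
  obtain ⟨S, F, hS, hF, hSF, hcrit⟩ := exists_isOddFamily_matchable_erase (d := 0) hE' (by
    have h1 := Finset.card_insert_le x (insert y T)
    have h2 := Finset.card_insert_le y T
    omega)
  -- If only members of `T` have partners in the sets of `F'`, then each of these odd sets uses up a
  -- vertex of `T`.
  have hle : ∀ F' ⊆ F, ∀ T ⊆ S, (∀ s ∈ S, s ∉ T → ∀ D ∈ F', f s ∉ D) → F'.card ≤ T.card := by
    intro F' hF' T hT hTF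
    refine (hf.card_le_of_odd (I := F') (C := id) (T := T) ?_ ?_ ?_).trans
      (Finset.card_le_card Finset.inter_subset_left)
    · exact fun D hD D' hD' hne ↦ Finset.disjoint_left.2 fun x hx hx' ↦
        hne (hF.eq_of_mem D (hF' hD) D' (hF' hD') x hx hx')
    · intro D hD
      rw [id, Finset.inter_eq_left.2 (hF.subset_of_mem D (hF' hD))]
      exact hF.odd D (hF' hD)
    · intro D hD c hc
      have hc := Finset.mem_inter.1 hc
      obtain ⟨h1, h2, h3⟩ := hf c hc.2
      have h4 := hF.adj D (hF' hD) c hc.1 _ h1 h2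
      by_contra! hcon
      exact hTF (f c) (h4.resolve_right hcon.1) hcon.2 D hD (h3.symm ▸ hc.1)
  have key : ∀ s ∈ S, ∃ D ∈ F, f s ∈ D := by
    intro s hs
    by_contra! hcon
    have h1 := hle F subset_rfl (S.erase s) (Finset.erase_subset _ _) (fun t ht hts D hD ↦ by
      obtain rfl : t = s := by grind
      exact hcon D hD)
    have h2 := Finset.card_erase_lt_of_mem hs
    omega
  choose! C hC hsC using key
  refine ⟨S, C, hS (by simp), hS (by simp), ⟨hF.subset, fun s hs ↦ hF.subset_of_mem _ (hC s hs),
    fun s hs ↦ hF.notMem _ (hC s hs), hsC, fun s hs ↦ hcrit _ (hC s hs),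
    fun s hs ↦ hF.adj _ (hC s hs), ?_⟩⟩
  intro s hs t ht c hcs hct
  have hCst := hF.eq_of_mem _ (hC s hs) _ (hC t ht) c hcs hct
  by_contra hne
  -- Two barrier vertices matched into one odd set would leave `S.card - 2` vertices for at least
  -- `S.card - 1` odd sets.
  have h1 := hle (F.erase (C s)) (Finset.erase_subset _ _) ((S.erase s).erase t) (by grind)
    (fun u hu hut D hD hfu ↦ by
      rw [Finset.mem_erase] at hD
      obtain rfl | rfl : u = s ∨ u = t := by grind
      · exact hD.1 (hF.eq_of_mem _ hD.2 _ (hC u hs) _ hfu (hsC u hs))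
      · exact hD.1 (hCst ▸ hF.eq_of_mem _ hD.2 _ (hC u ht) _ hfu (hsC u ht)))
  have h2 : t ∈ S.erase s := by grind
  have h3 := Finset.card_erase_of_mem h2
  have h4 := Finset.card_erase_of_mem hs
  have h5 := Finset.card_erase_of_mem (hC s hs)
  have h6 := Finset.card_pos.2 ⟨t, h2⟩
  omega

end SimpleGraph

/-! ### Factor-components as classes of vertices; transitivity. -/

namespace SimpleGraph

variable {α : Type*} [DecidableEq α] {Γ : SimpleGraph α} {f g : α → α}
  {A B C V X Y : Finset α}

/-- `x` and `y` are joined by an edge that lies in some perfect matching of `Γ[V]`. -/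
def AllowedAdj (Γ : SimpleGraph α) (V : Finset α) (x y : α) : Prop :=
  Γ.Adj x y ∧ x ∈ V ∧ y ∈ V ∧ Γ.Matchable ((V.erase x).erase y)

/-- `X` is a union of factor-components of `Γ[V]`. -/
def IsAllowedClosed (Γ : SimpleGraph α) (V X : Finset α) : Prop :=
  X ⊆ V ∧ ∀ x ∈ X, ∀ y, Γ.AllowedAdj V x y → y ∈ X

/-- `A` is the vertex set of a factor-component of `Γ[V]`. -/
def IsFactorClass (Γ : SimpleGraph α) (V A : Finset α) : Prop :=
  ∃ a ∈ V, ∀ z, z ∈ A ↔ Relation.ReflTransGen (Γ.AllowedAdj V) a z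

/-- If `Γ[X \ A]` has a perfect matching, this means that the contraction of `A` makes `Γ[X]`
factor-critical. -/
def IsCriticalOver (Γ : SimpleGraph α) (X A : Finset α) : Prop :=
  ∀ v ∈ X \ A, ∃ y ∈ A, Γ.Matchable (insert y ((X \ A).erase v))

lemma AllowedAdj.symm {x y : α} (h : Γ.AllowedAdj V x y) : Γ.AllowedAdj V y x :=
  ⟨h.1.symm, h.2.2.1, h.2.1, by rw [Finset.erase_right_comm]; exact h.2.2.2⟩

lemma reflTransGen_allowedAdj_symm {x y : α} (h : Relation.ReflTransGen (Γ.AllowedAdj V) x y) :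
    Relation.ReflTransGen (Γ.AllowedAdj V) y x :=
  have : Std.Symm (Γ.AllowedAdj V) := ⟨fun _ _ ↦ AllowedAdj.symm⟩
  Std.Symm.symm _ _ h

lemma IsPairing.allowedAdj {x : α} (hf : Γ.IsPairing f V) (hx : x ∈ V) :
    Γ.AllowedAdj V x (f x) := by
  obtain ⟨h1, h2, h3⟩ := hf x hx
  refine ⟨h2, hx, h1, (hf.mono (by grind) fun z hz ↦ ?_).matchable⟩
  have hz' : z ∈ V := by grind
  have := hf z hz'
  grind

lemma AllowedAdj.exists_isPairing {x y : α} (h : Γ.AllowedAdj V x y) :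
    ∃ g, Γ.IsPairing g V ∧ g x = y := by
  obtain ⟨h1, hx, hy, k, hk⟩ := h
  have hne := h1.ne
  refine ⟨fun z ↦ if z = x then y else if z = y then x else k z, fun z hz ↦ ?_, by simp⟩
  by_cases hzx : z = x
  · subst hzx
    simp [hy, h1, hne.symm]
  by_cases hzy : z = y
  · subst hzy
    simp [hx, h1.symm, hzx]
  have := hk z (by grind)
  grind

lemma IsPairing.mem_of_isAllowedClosed {x : α} (hf : Γ.IsPairing f V)
    (hX : Γ.IsAllowedClosed V X) (hx : x ∈ X) : f x ∈ X :=
  hX.2 x hx _ (hf.allowedAdj (hX.1 hx))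

lemma IsAllowedClosed.mem_of_reflTransGen {x y : α} (hX : Γ.IsAllowedClosed V X) (hx : x ∈ X)
    (h : Relation.ReflTransGen (Γ.AllowedAdj V) x y) : y ∈ X := by
  induction h with
  | refl => exact hx
  | tail _ h ih => exact hX.2 _ ih _ h

lemma IsFactorClass.reflTransGen {x y : α} (hA : Γ.IsFactorClass V A) (hx : x ∈ A) :
    y ∈ A ↔ Relation.ReflTransGen (Γ.AllowedAdj V) x y := by
  obtain ⟨a, -, ha⟩ := hA
  rw [ha] at hx ⊢
  exact ⟨fun hy ↦ (reflTransGen_allowedAdj_symm hx).trans hy, hx.trans⟩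

lemma IsFactorClass.isAllowedClosed (hA : Γ.IsFactorClass V A) : Γ.IsAllowedClosed V A := by
  obtain ⟨a, haV, ha⟩ := hA
  refine ⟨fun x hx ↦ ?_, fun x hx y hxy ↦ ?_⟩
  · rw [ha] at hx
    cases hx with
    | refl => exact haV
    | tail _ h => exact h.2.2.1
  · rw [ha] at hx ⊢
    exact hx.tail hxy

lemma IsFactorClass.nonempty (hA : Γ.IsFactorClass V A) : ∃ a, a ∈ A := by
  obtain ⟨a, -, ha⟩ := hA
  exact ⟨a, (ha a).2 .refl⟩

lemma IsFactorClass.subset_of_mem {x : α} (hA : Γ.IsFactorClass V A)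
    (hX : Γ.IsAllowedClosed V X) (hxA : x ∈ A) (hx : x ∈ X) : A ⊆ X := fun _ hy ↦
  hX.mem_of_reflTransGen hx ((hA.reflTransGen hxA).1 hy)

lemma IsFactorClass.eq_of_mem {x : α} (hA : Γ.IsFactorClass V A) (hB : Γ.IsFactorClass V B)
    (hxA : x ∈ A) (hxB : x ∈ B) : A = B :=
  (hA.subset_of_mem hB.isAllowedClosed hxA hxB).antisymm
    (hB.subset_of_mem hA.isAllowedClosed hxB hxA)

lemma IsAllowedClosed.union (hX : Γ.IsAllowedClosed V X) (hY : Γ.IsAllowedClosed V Y) :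
    Γ.IsAllowedClosed V (X ∪ Y) := by
  refine ⟨Finset.union_subset hX.1 hY.1, fun x hx y hxy ↦ ?_⟩
  rcases Finset.mem_union.1 hx with hx | hx
  · exact Finset.mem_union_left _ (hX.2 x hx y hxy)
  · exact Finset.mem_union_right _ (hY.2 x hx y hxy)

lemma IsPairing.sdiff (hf : Γ.IsPairing f V) (hX : Γ.IsAllowedClosed V X)
    (hY : Γ.IsAllowedClosed V Y) : Γ.IsPairing f (X \ Y) := by
  refine hf.mono (Finset.sdiff_subset.trans hX.1) fun x hx ↦ ?_
  rw [Finset.mem_sdiff] at hx ⊢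
  refine ⟨hf.mem_of_isAllowedClosed hX hx.1, fun h ↦ hx.2 ?_⟩
  have := hf.mem_of_isAllowedClosed hY h
  rwa [(hf x (hX.1 hx.1)).2.2] at this

/-- `f` pairs off `Y \ X` and `X \ A`, as these are differences of closed sets. Hence `v ∈ X` needs
only the condition on `X`, and `v ∈ Y \ X` needs an alternating path into `X`. -/
theorem IsCriticalOver.trans (hf : Γ.IsPairing f V) (hX : Γ.IsAllowedClosed V X)
    (hY : Γ.IsAllowedClosed V Y) (hA : Γ.IsAllowedClosed V A) (hAX : A ⊆ X) (hBX : B ⊆ X)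
    (hBY : B ⊆ Y) (hXA : Γ.IsCriticalOver X A) (hYB : Γ.IsCriticalOver Y B) :
    Γ.IsCriticalOver (X ∪ Y) A := by
  intro v hv
  have hD := hf.sdiff hY hX
  have hXA' := hf.sdiff hX hA
  by_cases hvX : v ∈ X
  · obtain ⟨y, hy, hm⟩ := hXA v (by grind)
    refine ⟨y, hy, ?_⟩
    have := hm.union hD.matchable (by rw [Finset.disjoint_left]; grind)
    convert this using 1
    grind
  obtain ⟨y, hy, g, hg⟩ := hYB v (by grind)
  -- As `B ⊆ X`, `g` covers `Y \ X` except for `v`; all of `g` lives in `Y`, so the exit vertex `g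
  -- x` is in `X`.
  obtain ⟨x, hx, hxv, hgx, hm⟩ := hD.exists_matchable_insert_erase (g := g) (v := v) (by grind)
    (fun x hx hxv ↦ by
      have := hg x (by grind)
      refine ⟨this.2.1, this.2.2, ?_⟩
      rintro rfl
      grind)
  have hgx' := (hg x (by grind)).1
  -- In `A`, the exit vertex is itself the extra vertex sought; in `X \ A`, it becomes the vertex
  -- that the matching from `hXA` must avoid.
  by_cases hw : g x ∈ A
  · refine ⟨g x, hw, ?_⟩
    have := hm.union hXA'.matchable (by rw [Finset.disjoint_left]; grind)
    convert this using 1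
    grind
  · obtain ⟨z, hz, hm'⟩ := hXA (g x) (by grind)
    refine ⟨z, hz, ?_⟩
    have := hm'.union hm (by rw [Finset.disjoint_left]; grind)
    convert this using 1
    grind

end SimpleGraph

/-! ### The digraph on a barrier: parity and counting. -/

namespace SimpleGraph

variable {α : Type*} [DecidableEq α] {Γ : SimpleGraph α} {f g : α → α}
  {A B V X Y S Q Z : Finset α} {C : α → Finset α}

/-- The digraph on a barrier `S` in which `s → t` if the odd component of `s` has an edge to `t`. -/
def BarrierArc (Γ : SimpleGraph α) (S : Finset α) (C : α → Finset α) (s t : α) : Prop :=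
  s ∈ S ∧ t ∈ S ∧ ∃ c ∈ C s, Γ.Adj c t

namespace IsCriticalBarrier

lemma pairwiseDisjoint (hb : Γ.IsCriticalBarrier f V S C) (hQ : Q ⊆ S) :
    (Q : Set α).PairwiseDisjoint C := fun s hs t ht hst ↦
  Finset.disjoint_left.2 fun x hx hx' ↦ hst (hb.eq_of_mem s (hQ hs) t (hQ ht) x hx hx')

lemma odd_card (hb : Γ.IsCriticalBarrier f V S C) {s : α} (hs : s ∈ S) : Odd (C s).card := by
  have h1 := (hb.matchable s hs _ (hb.partner_mem s hs)).even_card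
  rw [← Finset.card_erase_add_one (hb.partner_mem s hs)]
  exact h1.add_one

/-- Every perfect matching has just one edge that leaves an odd component. -/
lemma exit_unique (hb : Γ.IsCriticalBarrier f V S C) (hg : Γ.IsPairing g V) {s x y : α}
    (hs : s ∈ S) (hx : x ∈ C s) (hy : y ∈ C s) (hgx : g x ∉ C s) (hgy : g y ∉ C s) : x = y := by
  by_contra hne
  have hxV := hb.part_subset s hs hx
  have hyV := hb.part_subset s hs hy
  have hgxS := (hb.adj s hs x hx _ (hg x hxV).1 (hg x hxV).2.1).resolve_right hgx
  have hgyS := (hb.adj s hs y hy _ (hg y hyV).1 (hg y hyV).2.1).resolve_right hgy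
  have hgne : g x ≠ g y := fun h ↦ hne (hg.injOn hxV hyV h)
  -- With two barrier vertices taken by `C s`, only `S.card - 2` remain for the other `S.card - 1`
  -- components.
  have h1 := hg.card_le_of_odd (I := S.erase s) (T := (S.erase (g x)).erase (g y))
    (hb.pairwiseDisjoint (Finset.erase_subset _ _))
    (fun t ht ↦ by
      have ht := Finset.mem_of_mem_erase ht
      rw [Finset.inter_eq_left.2 (hb.part_subset t ht)]
      exact hb.odd_card ht)
    (fun t ht c hc ↦ by
      rw [Finset.mem_erase] at ht
      rw [Finset.mem_inter] at hc
      obtain ⟨h1, h2, h3⟩ := hg c hc.2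
      have h4 := hb.adj t ht.2 c hc.1 _ h1 h2
      have h5 : ∀ z ∈ C s, g c ≠ g z := fun z hz h ↦ by
        rw [hg.injOn hc.2 (hb.part_subset s hs hz) h] at hc
        exact ht.1 (hb.eq_of_mem t ht.2 s hs z hc.1 hz)
      have h6 := h5 x hx
      have h7 := h5 y hy
      grind)
  have h2 := Finset.card_le_card (Finset.inter_subset_left (s₁ := (S.erase (g x)).erase (g y))
    (s₂ := V))
  have h3 : g y ∈ S.erase (g x) := by grind
  rw [Finset.card_erase_of_mem h3, Finset.card_erase_of_mem hgxS] at h2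
  rw [Finset.card_erase_of_mem hs] at h1
  have := Finset.card_pos.2 ⟨_, h3⟩
  rw [Finset.card_erase_of_mem hgxS] at this
  omega

/-- A set that is closed under a perfect matching has an odd number of vertices in the component
of `s` if and only if it contains the vertex at which the matching leaves the component. -/
lemma odd_card_inter (hb : Γ.IsCriticalBarrier f V S C) (hg : Γ.IsPairing g Z)
    (hgV : Γ.IsPairing g V) {s x : α} (hs : s ∈ S) (hx : x ∈ C s) (hgx : g x ∉ C s)
    (hxZ : x ∈ Z) : Odd (C s ∩ Z).card := by
  have hxCZ : x ∈ C s ∩ Z := Finset.mem_inter.2 ⟨hx, hxZ⟩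
  rw [← Finset.card_erase_add_one hxCZ]
  refine (hg.mono (T := (C s ∩ Z).erase x) (by grind) fun z hz ↦ ?_).even_card.add_one
  have hzZ : z ∈ Z := by grind
  have h1 := hg z hzZ
  have h2 : g z ∈ C s := by
    by_contra h
    have := hb.exit_unique hgV hs hx (by grind) hgx h
    grind
  have h3 : g z ≠ x := by grind
  grind

lemma even_card_inter (hb : Γ.IsCriticalBarrier f V S C) (hg : Γ.IsPairing g Z)
    (hgV : Γ.IsPairing g V) {s x : α} (hs : s ∈ S) (hx : x ∈ C s) (hgx : g x ∉ C s)
    (hxZ : x ∉ Z) : Even (C s ∩ Z).card := by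
  refine (hg.mono (T := C s ∩ Z) (by grind) fun z hz ↦ ?_).even_card
  have hzZ : z ∈ Z := by grind
  have h1 := hg z hzZ
  have h2 : g z ∈ C s := by
    by_contra h
    have := hb.exit_unique hgV hs hx (by grind) hgx h
    grind
  grind

/-- The matching `f` leaves `C s` at `f s`, and `Z` contains this vertex along with its partner `s`.
-/
lemma odd_card_inter_of_mem (hb : Γ.IsCriticalBarrier f V S C) (hf : Γ.IsPairing f V)
    (hZ : Γ.IsPairing f Z) {s : α} (hs : s ∈ S) (hsZ : s ∈ Z) :
    Odd (C s ∩ Z).card := by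
  refine hb.odd_card_inter hZ hf hs (hb.partner_mem s hs) ?_ (hZ s hsZ).1
  rw [(hZ s hsZ).2.2]
  exact fun h ↦ hb.notMem s hs s h hs

lemma even_card_inter_of_notMem (hb : Γ.IsCriticalBarrier f V S C) (hf : Γ.IsPairing f V)
    (hZ : Γ.IsPairing f Z) {s : α} (hs : s ∈ S) (hsZ : s ∉ Z) :
    Even (C s ∩ Z).card := by
  have h1 := (hf s (hb.subset hs)).2.2
  refine hb.even_card_inter hZ hf hs (hb.partner_mem s hs) ?_ fun h ↦ ?_
  · rw [h1]
    exact fun h ↦ hb.notMem s hs s h hs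
  · have := (hZ _ h).1
    rw [h1] at this
    exact hsZ this

/-- A set of vertices of the barrier that is closed under arcs, with the odd components of its
members, is a union of factor-components. -/
lemma isAllowedClosed (hb : Γ.IsCriticalBarrier f V S C) (hQ : Q ⊆ S)
    (hcl : ∀ s ∈ Q, ∀ t, Γ.BarrierArc S C s t → t ∈ Q) :
    Γ.IsAllowedClosed V (Q ∪ Q.biUnion C) := by
  refine ⟨Finset.union_subset (hQ.trans hb.subset) (Finset.biUnion_subset.2 fun s hs ↦
    hb.part_subset s (hQ hs)), fun p hp q hpq ↦ ?_⟩
  have hstep : ∀ s ∈ Q, ∀ c ∈ C s, ∀ w ∈ V, Γ.Adj c w → w ∈ Q ∨ w ∈ C s := by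
    intro s hs c hc w hw hcw
    exact (hb.adj s (hQ hs) c hc w hw hcw).imp_left fun h ↦
      hcl s hs w ⟨hQ hs, h, c, hc, hcw⟩
  have hC : ∀ s ∈ Q, ∀ c ∈ C s, c ∈ Q ∪ Q.biUnion C := fun s hs c hc ↦
    Finset.mem_union_right _ (Finset.mem_biUnion.2 ⟨s, hs, hc⟩)
  rcases Finset.mem_union.1 hp with hp | hp
  · obtain ⟨g, hg, rfl⟩ := hpq.exists_isPairing
    by_contra hcon
    have h1 := hg.card_le_of_odd (I := Q) (T := Q.erase p) (hb.pairwiseDisjoint hQ)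
      (fun t ht ↦ by
        rw [Finset.inter_eq_left.2 (hb.part_subset t (hQ ht))]
        exact hb.odd_card (hQ ht))
      (fun t ht c hc ↦ by
        rw [Finset.mem_inter] at hc
        obtain ⟨h1, h2, h3⟩ := hg c hc.2
        have h4 := hstep t ht c hc.1 _ h1 h2
        have h5 : g c ≠ p := by
          rintro rfl
          rw [h3] at hcon
          exact hcon (hC t ht c hc.1)
        grind)
    have h2 := Finset.card_le_card (Finset.inter_subset_left (s₁ := Q.erase p) (s₂ := V))
    have h3 := Finset.card_erase_lt_of_mem hp
    omega
  · obtain ⟨s, hs, hps⟩ := Finset.mem_biUnion.1 hp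
    rcases hstep s hs p hps q hpq.2.2.1 hpq.1 with h | h
    · exact Finset.mem_union_left _ h
    · exact hC s hs q h

/-- If such a set meets `X`, where `Γ[X] / A` is factor-critical, then it meets `A`. -/
lemma exists_mem_of_isCriticalOver (hb : Γ.IsCriticalBarrier f V S C) (hf : Γ.IsPairing f V)
    (hQ : Q ⊆ S) (hcl : ∀ s ∈ Q, ∀ t, Γ.BarrierArc S C s t → t ∈ Q)
    (hX : Γ.IsAllowedClosed V X) (hA : Γ.IsAllowedClosed V A)
    (hXA : Γ.IsCriticalOver X A) {x : α} (hxX : x ∈ X) (hxQ : x ∈ Q ∪ Q.biUnion C) :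
    ∃ a ∈ A, a ∈ Q ∪ Q.biUnion C := by
  by_contra! hcon
  have hZ := hf.sdiff hX hA
  have hC : ∀ s ∈ Q, ∀ c ∈ C s, c ∈ Q ∪ Q.biUnion C := fun s hs c hc ↦
    Finset.mem_union_right _ (Finset.mem_biUnion.2 ⟨s, hs, hc⟩)
  have hQA : ∀ s ∈ Q, s ∉ A := fun s hs hsA ↦ hcon s hsA (Finset.mem_union_left _ hs)
  have hCA : ∀ s ∈ Q, ∀ c ∈ C s, c ∉ A := fun s hs c hc hcA ↦ hcon c hcA (hC s hs c hc)
  have hstep : ∀ s ∈ Q, ∀ c ∈ C s, ∀ w ∈ V, Γ.Adj c w → w ∈ Q ∨ w ∈ C s := by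
    intro s hs c hc w hw hcw
    exact (hb.adj s (hQ hs) c hc w hw hcw).imp_left fun h ↦
      hcl s hs w ⟨hQ hs, h, c, hc, hcw⟩
  -- the number of odd sets exceeds the number of vertices to which they may be matched
  have key : ∀ v ∈ X \ A, ∀ I ⊆ Q, (∀ s ∈ I, Odd (C s ∩ (X \ A).erase v).card) →
      I.card ≤ (Q ∩ (X \ A).erase v).card := by
    intro v hv I hI hodd
    obtain ⟨y, hyA, g, hg⟩ := hXA v hv
    -- The extra vertex `y` lies in `A`, which the set is assumed to miss, so it affects none of the
    -- counts.
    have hyQ : y ∉ Q := fun h ↦ hQA y h hyA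
    have hyC : ∀ s ∈ Q, y ∉ C s := fun s hs h ↦ hCA s hs y h hyA
    have h1 := hg.card_le_of_odd (I := I) (T := Q) (C := C) (hb.pairwiseDisjoint (hI.trans hQ))
      (fun s hs ↦ by
        rw [Finset.inter_insert_of_notMem (hyC s (hI hs))]
        exact hodd s hs)
      (fun s hs c hc ↦ by
        rw [Finset.mem_inter] at hc
        obtain ⟨h1, h2, h3⟩ := hg c hc.2
        refine (hstep s (hI hs) c hc.1 _ ?_ h2).symm
        rcases Finset.mem_insert.1 h1 with h | h
        · exact h ▸ hA.1 hyA
        · exact hX.1 (Finset.mem_sdiff.1 (Finset.mem_of_mem_erase h)).1)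
    rwa [Finset.inter_insert_of_notMem hyQ] at h1
  -- Deleting `s` keeps the components of all members of `Q ∩ (X \ A)` odd, but removes one vertex
  -- available to them.
  have case_mem : ∀ s ∈ Q, s ∈ X → False := by
    intro s hs hsX
    have hsZ : s ∈ X \ A := Finset.mem_sdiff.2 ⟨hsX, hQA s hs⟩
    have h1 := key s hsZ (Q ∩ (X \ A)) Finset.inter_subset_left fun t ht ↦ by
      rw [Finset.mem_inter] at ht
      rw [Finset.inter_erase, Finset.erase_eq_of_notMem]
      · exact hb.odd_card_inter_of_mem hf hZ (hQ ht.1) ht.2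
      · exact fun h ↦ hb.notMem t (hQ ht.1) s (Finset.mem_inter.1 h).1 (hQ hs)
    rw [Finset.inter_erase] at h1
    have h2 := Finset.card_erase_lt_of_mem (s := Q ∩ (X \ A)) (a := s) (by grind)
    omega
  rcases Finset.mem_union.1 hxQ with hxQ | hxQ
  · exact case_mem x hxQ hxX
  obtain ⟨s, hs, hxs⟩ := Finset.mem_biUnion.1 hxQ
  by_cases hsX : s ∈ X
  · exact case_mem s hs hsX
  have hxZ : x ∈ X \ A := Finset.mem_sdiff.2 ⟨hxX, hCA s hs x hxs⟩
  have hsI : s ∉ Q ∩ (X \ A) := by grind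
  -- Since `s ∉ X`, `C s ∩ (X \ A)` is even, and deleting `x` from it creates one odd set too many.
  have h1 := key x hxZ (insert s (Q ∩ (X \ A)))
    (Finset.insert_subset hs Finset.inter_subset_left) fun t ht ↦ by
      rw [Finset.inter_erase]
      by_cases hts : t = s
      · subst hts
        have h1 : x ∈ C t ∩ (X \ A) := Finset.mem_inter.2 ⟨hxs, hxZ⟩
        have h2 := hb.even_card_inter_of_notMem hf hZ (hQ hs) (by grind)
        have h3 := Finset.card_pos.2 ⟨_, h1⟩
        rw [Finset.card_erase_of_mem h1, Nat.odd_iff]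
        rw [Nat.even_iff] at h2
        omega
      · have ht' : t ∈ Q ∩ (X \ A) := by grind
        rw [Finset.mem_inter] at ht'
        rw [Finset.erase_eq_of_notMem]
        · exact hb.odd_card_inter_of_mem hf hZ (hQ ht'.1) ht'.2
        · exact fun h ↦ hts (hb.eq_of_mem t (hQ ht'.1) s (hQ hs) x (Finset.mem_inter.1 h).1 hxs)
  rw [Finset.card_insert_of_notMem hsI] at h1
  have h2 : Q ∩ (X \ A).erase x ⊆ Q ∩ (X \ A) := by grind
  have h3 := Finset.card_le_card h2
  omega

end IsCriticalBarrier

end SimpleGraph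

/-! ### Strong components of the digraph; antisymmetry. -/

namespace SimpleGraph

variable {α : Type*} [DecidableEq α] {Γ : SimpleGraph α} {f g : α → α}
  {A B V X Y S Q Z : Finset α} {C : α → Finset α}

namespace IsCriticalBarrier

open Relation

/-- By Hall's theorem, if `a` can be reached from `b`, then the odd components other than that of `a`
can be matched along arcs to the vertices of the barrier other than `b`. -/
lemma exists_injOn_arc (hb : Γ.IsCriticalBarrier f V S C) (hf : Γ.IsPairing f V) {a b : α}
    (hba : ReflTransGen (Γ.BarrierArc S C) b a) :
    ∃ φ : α → α, Set.InjOn φ (S.erase a) ∧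
      ∀ t ∈ S.erase a, φ t ≠ b ∧ Γ.BarrierArc S C t (φ t) := by
  classical
  have hself : ∀ t ∈ S, Γ.BarrierArc S C t t := fun t ht ↦
    ⟨ht, ht, f t, hb.partner_mem t ht, (hf t (hb.subset ht)).2.1.symm⟩
  let N : {t // t ∈ S.erase a} → Finset α := fun t ↦ {u ∈ S | u ≠ b ∧ Γ.BarrierArc S C t u}
  have hN : ∀ t u, u ∈ N t ↔ u ≠ b ∧ Γ.BarrierArc S C t u := by
    intro t u
    simp only [N, Finset.mem_filter, and_iff_right_iff_imp]
    exact fun h ↦ h.2.2.1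
  have hall : ∀ s : Finset {t // t ∈ S.erase a}, s.card ≤ (s.biUnion N).card := by
    intro s
    by_contra! hlt
    let T : Finset α := s.map (Function.Embedding.subtype _)
    have hT : ∀ t, t ∈ T ↔ ∃ h : t ∈ S.erase a, ⟨t, h⟩ ∈ s := by simp [T]
    have hTcard : T.card = s.card := Finset.card_map _
    -- Every barrier vertex has an arc to itself, so a set `T` that violates Hall's condition
    -- contains `b` and its neighbourhood is just `T - b`. Then `T` is closed under arcs and
    -- contains `a`, which was excluded.
    have hTN : T.erase b ⊆ s.biUnion N := by
      intro t ht
      rw [Finset.mem_erase, hT] at ht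
      obtain ⟨htb, ht, hts⟩ := ht
      exact Finset.mem_biUnion.2 ⟨_, hts, (hN _ _).2 ⟨htb, hself t (Finset.mem_of_mem_erase ht)⟩⟩
    have hle := Finset.card_le_card hTN
    have hbT : b ∈ T := by
      by_contra hbT
      rw [Finset.erase_eq_of_notMem hbT] at hle
      omega
    rw [Finset.card_erase_of_mem hbT] at hle
    have heq : T.erase b = s.biUnion N := Finset.eq_of_subset_of_card_le hTN (by
      rw [Finset.card_erase_of_mem hbT]; omega)
    have hcl : ∀ t, ReflTransGen (Γ.BarrierArc S C) b t → t ∈ T := by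
      intro t ht
      induction ht with
      | refl => exact hbT
      | @tail u w _ huw ih =>
        by_cases hwb : w = b
        · exact hwb ▸ hbT
        obtain ⟨hu, hus⟩ := (hT u).1 ih
        have : w ∈ s.biUnion N := Finset.mem_biUnion.2 ⟨_, hus, (hN _ _).2 ⟨hwb, huw⟩⟩
        rw [← heq] at this
        exact Finset.mem_of_mem_erase this
    obtain ⟨h, -⟩ := (hT a).1 (hcl a hba)
    simp at h
  obtain ⟨φ, hφ, hφN⟩ := (Finset.all_card_le_biUnion_card_iff_exists_injective N).1 hall
  refine ⟨fun t ↦ if h : t ∈ S.erase a then φ ⟨t, h⟩ else t, ?_, ?_⟩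
  · intro t ht u hu htu
    rw [Finset.mem_coe] at ht hu
    simp only [ht, hu, dif_pos] at htu
    exact congrArg Subtype.val (hφ htu)
  · intro t ht
    simp only [ht, dif_pos]
    exact (hN _ _).1 (hφN ⟨t, ht⟩)

/-- An arc in a strong component of the digraph on the barrier comes from an allowed edge. -/
lemma allowedAdj_of_arc (hb : Γ.IsCriticalBarrier f V S C) (hf : Γ.IsPairing f V) {a b c : α}
    (hab : Γ.BarrierArc S C a b) (hc : c ∈ C a) (hcb : Γ.Adj c b)
    (hba : ReflTransGen (Γ.BarrierArc S C) b a) : Γ.AllowedAdj V c b := by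
  -- A perfect matching of `V - c - b` is put together from `C a - c`, from each other `C t` along
  -- with `φ t`, and from `f` on the vertices outside `S` and its components. It covers `S - b`
  -- because `φ` is onto by cardinality.
  obtain ⟨φ, hφ, hφS⟩ := hb.exists_injOn_arc hf hba
  have haS := hab.1
  have hbS := hab.2.1
  refine ⟨hcb, hb.part_subset a haS hc, hb.subset hbS, ?_⟩
  have himg : (S.erase a).image φ = S.erase b := by
    refine Finset.eq_of_subset_of_card_le ?_ ?_
    · intro u hu
      obtain ⟨t, ht, rfl⟩ := Finset.mem_image.1 hu
      exact Finset.mem_erase.2 ⟨(hφS t ht).1, (hφS t ht).2.2.1⟩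
    · rw [Finset.card_image_of_injOn hφ, Finset.card_erase_of_mem haS,
        Finset.card_erase_of_mem hbS]
  have hpart : ∀ t ∈ S.erase a, Γ.Matchable (insert (φ t) (C t)) := by
    intro t ht
    obtain ⟨htS, hφt, d, hd, hdφ⟩ := (hφS t ht).2
    exact (hb.matchable t htS d hd).of_erase hd (fun h ↦ hb.notMem t htS _ h hφt) hdφ
  have hdisj : ((S.erase a : Finset α) : Set α).PairwiseDisjoint fun t ↦ insert (φ t) (C t) := by
    intro t ht u hu htu
    have ht' := Finset.mem_of_mem_erase ht
    have hu' := Finset.mem_of_mem_erase hu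
    refine Finset.disjoint_left.2 fun x hx hx' ↦ ?_
    rw [Finset.mem_insert] at hx hx'
    have h1 := (hφS t ht).2.2.1
    have h2 := (hφS u hu).2.2.1
    rcases hx with rfl | hx <;> rcases hx' with hx' | hx'
    · exact htu (hφ ht hu hx')
    · exact hb.notMem u hu' _ hx' h1
    · exact hb.notMem t ht' _ hx (hx' ▸ h2)
    · exact htu (hb.eq_of_mem t ht' u hu' x hx hx')
  have hrest : Γ.IsPairing f (V \ (S ∪ S.biUnion C)) := by
    refine hf.mono Finset.sdiff_subset fun x hx ↦ ?_
    simp only [Finset.mem_sdiff, Finset.mem_union, Finset.mem_biUnion, not_or, not_exists,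
      not_and] at hx ⊢
    obtain ⟨hxV, hxS, hxC⟩ := hx
    obtain ⟨h1, h2, h3⟩ := hf x hxV
    refine ⟨h1, fun h ↦ ?_, fun s hs h ↦ ?_⟩
    · have := hb.partner_mem _ h
      rw [h3] at this
      exact hxC _ h this
    · rcases hb.adj s hs _ h x hxV h2.symm with h4 | h4
      · exact hxS h4
      · exact hxC s hs h4
  have h1 := (hb.matchable a haS c hc).union (Matchable.biUnion hpart hdisj) (by
    rw [Finset.disjoint_biUnion_right]
    intro t ht
    rw [Finset.disjoint_left]
    intro x hx hx'
    have hx := Finset.mem_of_mem_erase hx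
    rcases Finset.mem_insert.1 hx' with rfl | hx'
    · exact hb.notMem a haS _ hx (hφS t ht).2.2.1
    · rw [Finset.mem_erase] at ht
      exact ht.1 (hb.eq_of_mem t ht.2 a haS x hx' hx))
  have hbi : ∀ x, x ∈ (S.erase a).biUnion (fun t ↦ insert (φ t) (C t)) ↔
      x ∈ S.erase b ∨ ∃ t ∈ S.erase a, x ∈ C t := by
    intro x
    rw [← himg]
    simp only [Finset.mem_biUnion, Finset.mem_insert, Finset.mem_image]
    constructor
    · rintro ⟨t, ht, rfl | h⟩
      · exact Or.inl ⟨t, ht, rfl⟩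
      · exact Or.inr ⟨t, ht, h⟩
    · rintro (⟨t, ht, rfl⟩ | ⟨t, ht, h⟩)
      · exact ⟨t, ht, Or.inl rfl⟩
      · exact ⟨t, ht, Or.inr h⟩
  have h2 := h1.union hrest.matchable (by
    rw [Finset.disjoint_left]
    intro x hx hx'
    simp only [Finset.mem_sdiff, Finset.mem_union, Finset.mem_biUnion, not_or, not_exists,
      not_and] at hx'
    rw [Finset.mem_union, hbi] at hx
    rcases hx with hx | hx | ⟨t, ht, hx⟩
    · exact hx'.2.2 a haS (Finset.mem_of_mem_erase hx)
    · exact hx'.2.1 (Finset.mem_of_mem_erase hx)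
    · exact hx'.2.2 t (Finset.mem_of_mem_erase ht) hx)
  convert h2 using 1
  ext x
  simp only [Finset.mem_union, hbi, Finset.mem_sdiff, Finset.mem_biUnion, Finset.mem_erase]
  constructor
  · rintro ⟨hxb, hxc, hxV⟩
    by_cases hxS : x ∈ S
    · exact Or.inl (Or.inr (Or.inl ⟨hxb, hxS⟩))
    by_cases hxC : ∃ t ∈ S, x ∈ C t
    · obtain ⟨t, ht, hxt⟩ := hxC
      by_cases hta : t = a
      · subst hta
        exact Or.inl (Or.inl ⟨hxc, hxt⟩)
      · exact Or.inl (Or.inr (Or.inr ⟨t, ⟨hta, ht⟩, hxt⟩))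
    · exact Or.inr ⟨hxV, by simp only [not_or]; exact ⟨hxS, hxC⟩⟩
  · rintro ((⟨hxc, hxa⟩ | ⟨hxb, hxS⟩ | ⟨t, ⟨hta, ht⟩, hxt⟩) | ⟨hxV, hx⟩)
    · exact ⟨fun h ↦ hb.notMem a haS x hxa (h ▸ hbS), hxc, hb.part_subset a haS hxa⟩
    · exact ⟨hxb, fun h ↦ hb.notMem a haS c hc (h ▸ hxS), hb.subset hxS⟩
    · exact ⟨fun h ↦ hb.notMem t ht x hxt (h ▸ hbS),
        fun h ↦ hta (hb.eq_of_mem t ht a haS x hxt (h ▸ hc)), hb.part_subset t ht hxt⟩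
    · rw [not_or] at hx
      exact ⟨fun h ↦ hx.1 (h ▸ hbS), fun h ↦ hx.2 ⟨a, haS, h ▸ hc⟩, hxV⟩

/-- The ends of an arc in a strong component of the digraph on the barrier are in the same
factor-component. -/
lemma mem_factorClass_of_arc (hb : Γ.IsCriticalBarrier f V S C) (hf : Γ.IsPairing f V) {a b : α}
    (hA : Γ.IsAllowedClosed V A) (hbA : b ∈ A) (hab : Γ.BarrierArc S C a b)
    (hba : ReflTransGen (Γ.BarrierArc S C) b a) : a ∈ A := by
  obtain ⟨c, hc, hcb⟩ := hab.2.2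
  have h := hb.allowedAdj_of_arc hf hab hc hcb hba
  have hcA : c ∈ A := hA.2 b hbA c h.symm
  obtain ⟨g, hg, hgc⟩ := h.exists_isPairing
  have hgA : Γ.IsPairing g A := hg.mono hA.1 fun x hx ↦ hg.mem_of_isAllowedClosed hA hx
  have hfA : Γ.IsPairing f A := hf.mono hA.1 fun x hx ↦ hf.mem_of_isAllowedClosed hA hx
  -- The matching `g` leaves `C a` at `c ∈ A`, so `C a ∩ A` is odd; computed with `f` it would be
  -- even if `a ∉ A`.
  have hodd := hb.odd_card_inter hgA hg hab.1 hc
    (fun h ↦ hb.notMem a hab.1 _ h (hgc ▸ hab.2.1)) hcA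
  by_contra haA
  exact Nat.not_even_iff_odd.2 hodd (hb.even_card_inter_of_notMem hf hfA hab.1 haA)

lemma mem_factorClass_of_reflTransGen (hb : Γ.IsCriticalBarrier f V S C) (hf : Γ.IsPairing f V)
    {a b : α} (hA : Γ.IsAllowedClosed V A) (hbA : b ∈ A)
    (hab : ReflTransGen (Γ.BarrierArc S C) a b) (hba : ReflTransGen (Γ.BarrierArc S C) b a) :
    a ∈ A := by
  induction hab using ReflTransGen.head_induction_on with
  | refl => exact hbA
  | head h h' ih => exact hb.mem_factorClass_of_arc hf hA (ih (hba.tail h)) h (h'.trans hba)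

/-- If `Γ[X] / A` is factor-critical and the near-perfect matching that exposes `v` uses an edge
joining two vertices of the barrier, then `v` is in the odd component of some `s ∈ X \ A`. -/
lemma exists_part_mem (hb : Γ.IsCriticalBarrier f V S C) (hf : Γ.IsPairing f V)
    (hZ : Γ.IsPairing f Z) (hZV : Z ⊆ V) {v y : α} (hyV : y ∈ V)
    (hyS : y ∈ S) (hg : Γ.IsPairing g (insert y (Z.erase v))) (hgy : g y ∈ S) :
    ∃ s ∈ S, s ∈ Z ∧ v ∈ C s := by
  by_contra! hcon
  obtain ⟨h1, h2, h3⟩ := hg y (Finset.mem_insert_self _ _)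
  have hne := h2.ne'
  have hgyZ : g y ∈ Z.erase v := Finset.mem_of_mem_insert_of_ne h1 hne
  -- If `v` is in none of these components, they all remain odd, while `g y ∈ S ∩ Z` is already
  -- spent on `y`.
  have hle := hg.card_le_of_odd (I := S ∩ Z) (T := (S.erase y).erase (g y)) (C := C)
    (hb.pairwiseDisjoint Finset.inter_subset_left)
    (fun s hs ↦ by
      rw [Finset.mem_inter] at hs
      rw [Finset.inter_insert_of_notMem fun h ↦ hb.notMem s hs.1 y h hyS, Finset.inter_erase,
        Finset.erase_eq_of_notMem fun h ↦ hcon s hs.1 hs.2 (Finset.mem_inter.1 h).1]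
      exact hb.odd_card_inter_of_mem hf hZ hs.1 hs.2)
    (fun s hs c hc ↦ by
      rw [Finset.mem_inter] at hs hc
      obtain ⟨h4, h5, h6⟩ := hg c hc.2
      have h7 := hb.adj s hs.1 c hc.1 (g c) (by grind) h5
      have h8 := hb.notMem s hs.1 c hc.1
      have h9 : g c ≠ y := by grind
      have h10 : g c ≠ g y := by grind
      grind)
  have hsub : (S.erase y).erase (g y) ∩ insert y (Z.erase v) ⊆ (S ∩ Z).erase (g y) := by grind
  have h4 := Finset.card_le_card hsub
  have h5 := Finset.card_erase_lt_of_mem (s := S ∩ Z) (a := g y) (by grind)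
  omega

end IsCriticalBarrier

/-- The relation that defines the order of the factor-components is antisymmetric. -/
theorem IsFactorClass.eq_of_isCriticalOver (hf : Γ.IsPairing f V) (hA : Γ.IsFactorClass V A)
    (hB : Γ.IsFactorClass V B) (hX : Γ.IsAllowedClosed V X) (hY : Γ.IsAllowedClosed V Y)
    (hBX : B ⊆ X) (hAY : A ⊆ Y) (hXA : Γ.IsCriticalOver X A) (hYB : Γ.IsCriticalOver Y B) :
    A = B := by
  classical
  by_contra hne
  have hAc := hA.isAllowedClosed
  have hBc := hB.isAllowedClosed
  obtain ⟨v, hvB⟩ := hB.nonempty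
  have hvA : v ∉ A := fun h ↦ hne (hA.eq_of_mem hB h hvB)
  have hvZ : v ∈ X \ A := Finset.mem_sdiff.2 ⟨hBX hvB, hvA⟩
  obtain ⟨y, hyA, g, hg⟩ := hXA v hvZ
  have hyZ : y ∉ X \ A := by grind
  have hyV := hAc.1 hyA
  obtain ⟨h1, h2, -⟩ := hg y (Finset.mem_insert_self _ _)
  have hgyZ : g y ∈ X \ A := by
    have := h2.ne
    grind
  have hgyV : g y ∈ V := hX.1 (Finset.mem_sdiff.1 hgyZ).1
  -- The edge from `y` to `g y` leaves the class `A`, so it cannot be allowed.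
  obtain ⟨S, C, hyS, hgyS, hb⟩ := hf.exists_isCriticalBarrier hyV hgyV h2.ne fun hm ↦
    (Finset.mem_sdiff.1 hgyZ).2 (hAc.2 y hyA _ ⟨h2, hyV, hgyV, hm⟩)
  obtain ⟨s, hs, hsZ, hvs⟩ := hb.exists_part_mem hf (hf.sdiff hX hAc)
    (Finset.sdiff_subset.trans hX.1) hyV hyS hg hgyS
  let R : α → Finset α := fun u ↦ {t ∈ S | Relation.ReflTransGen (Γ.BarrierArc S C) u t}
  have hRS : ∀ u, R u ⊆ S := fun u ↦ Finset.filter_subset _ _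
  have hRcl : ∀ u, ∀ t ∈ R u, ∀ w, Γ.BarrierArc S C t w → w ∈ R u := by
    intro u t ht w htw
    simp only [R, Finset.mem_filter] at ht ⊢
    exact ⟨htw.2.1, ht.2.tail htw⟩
  have hRself : ∀ u ∈ S, u ∈ R u := fun u hu ↦ Finset.mem_filter.2 ⟨hu, .refl⟩
  have hRu : ∀ u, Γ.IsAllowedClosed V (R u ∪ (R u).biUnion C) := fun u ↦
    hb.isAllowedClosed (hRS u) (hRcl u)
  -- The closed set of `R s` contains `v ∈ X`, hence meets `A` and contains all of it, in particular
  -- `y`, which as a barrier vertex must be in `R s`.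
  have hsy : y ∈ R s := by
    obtain ⟨a, haA, ha⟩ := hb.exists_mem_of_isCriticalOver hf (hRS s) (hRcl s) hX hAc hXA
      (hBX hvB) (Finset.mem_union_right _ (Finset.mem_biUnion.2 ⟨s, hRself s hs, hvs⟩))
    rcases Finset.mem_union.1 (hA.subset_of_mem (hRu s) haA ha hyA) with h | h
    · exact h
    · obtain ⟨t, ht, hyt⟩ := Finset.mem_biUnion.1 h
      exact absurd hyS (hb.notMem t (hRS s ht) y hyt)
  -- The closed set of `R y` contains `y ∈ Y`, hence contains `B` and `v`; but `C s` is the only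
  -- component with `v`.
  have hys : s ∈ R y := by
    obtain ⟨b, hbB, hb'⟩ := hb.exists_mem_of_isCriticalOver hf (hRS y) (hRcl y) hY hBc hYB
      (hAY hyA) (Finset.mem_union_left _ (hRself y hyS))
    rcases Finset.mem_union.1 (hB.subset_of_mem (hRu y) hbB hb' hvB) with h | h
    · exact absurd (hRS y h) (hb.notMem s hs v hvs)
    · obtain ⟨t, ht, hvt⟩ := Finset.mem_biUnion.1 h
      rwa [hb.eq_of_mem s hs t (hRS y ht) v hvs hvt]
  exact (Finset.mem_sdiff.1 hsZ).2 (hb.mem_factorClass_of_reflTransGen hf hAc hyA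
    (Finset.mem_filter.1 hsy).2 (Finset.mem_filter.1 hys).2)

end SimpleGraph

/-! ### Transfer of pairings along a map. -/

namespace SimpleGraph

variable {α γ : Type*} {Γ : SimpleGraph α} {Δ : SimpleGraph γ} {Z : Finset α} {T : Finset γ}
  {r : α → γ}

/-- `Z` is a system of representatives. Adjacency is lifted only for pairs matched by `h`, since
another edge of a contraction may end at a different member of the contracted class. -/
lemma Matchable.of_injOn {h : γ → γ} (hh : Δ.IsPairing h T) (hr : Set.InjOn r Z)
    (hT : ∀ p, p ∈ T ↔ ∃ z ∈ Z, r z = p)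
    (hadj : ∀ z ∈ Z, ∀ w ∈ Z, Δ.Adj (r z) (r w) → h (r z) = r w → Γ.Adj z w) :
    Γ.Matchable Z := by
  have : ∀ z, ∃ w, z ∈ Z → w ∈ Z ∧ r w = h (r z) := by
    intro z
    by_cases hz : z ∈ Z
    · obtain ⟨w, hw⟩ := (hT _).1 (hh (r z) ((hT _).2 ⟨z, hz, rfl⟩)).1
      exact ⟨w, fun _ ↦ hw⟩
    · exact ⟨z, fun h ↦ absurd h hz⟩
  choose g hg using this
  refine ⟨g, fun z hz ↦ ?_⟩
  obtain ⟨h1, h2⟩ := hg z hz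
  obtain ⟨h3, h4⟩ := hg (g z) h1
  obtain ⟨h5, h6, h7⟩ := hh (r z) ((hT _).2 ⟨z, hz, rfl⟩)
  exact ⟨h1, hadj z hz _ h1 (h2 ▸ h6) h2.symm, hr h3 hz (by rw [h4, h2, h7])⟩

lemma IsPairing.matchable_image {g : α → α} (hg : Γ.IsPairing g Z) (hr : Set.InjOn r Z)
    (hT : ∀ p, p ∈ T ↔ ∃ z ∈ Z, r z = p) (hadj : ∀ z ∈ Z, Δ.Adj (r z) (r (g z))) :
    Δ.Matchable T := by
  have : ∀ p, ∃ q, ∀ z ∈ Z, r z = p → q = r (g z) := by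
    intro p
    by_cases hp : ∃ z ∈ Z, r z = p
    · obtain ⟨z, hz, rfl⟩ := hp
      exact ⟨r (g z), fun w hw hwz ↦ by rw [hr hw hz hwz]⟩
    · exact ⟨p, fun z hz h ↦ absurd ⟨z, hz, h⟩ hp⟩
  choose h hh using this
  refine ⟨h, fun p hp ↦ ?_⟩
  obtain ⟨z, hz, rfl⟩ := (hT p).1 hp
  obtain ⟨h1, -, h3⟩ := hg z hz
  rw [hh _ z hz rfl]
  refine ⟨(hT _).2 ⟨_, h1, rfl⟩, hadj z hz, ?_⟩
  rw [hh _ (g z) h1 rfl, h3]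

end SimpleGraph

/-! ### From multigraphs and contractions to simple graphs. -/

namespace Graph

open SimpleGraph Relation

variable {α β : Type*} {G : Graph α β} {f : α → α} {V X A : Finset α}

/-- The simple graph that results from `G` by the deletion of loops and the identification of
parallel edges. -/
def simplify (G : Graph α β) : SimpleGraph α where
  Adj x y := x ≠ y ∧ G.Adj x y
  symm := ⟨fun _ _ h ↦ ⟨h.1.symm, h.2.symm⟩⟩
  loopless := ⟨fun _ h ↦ h.1 rfl⟩

lemma IsPerfectMatching.exists_isPairing {M : Set β} (hM : G.IsPerfectMatching M)
    (hV : (V : Set α) = G.vertexSet) :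
    ∃ f, G.simplify.IsPairing f V ∧ ∀ e ∈ M, ∀ x y, G.IsLink e x y → f x = y := by
  have hmem : ∀ x, x ∈ V ↔ x ∈ G.vertexSet := fun x ↦ by rw [← hV, Finset.mem_coe]
  have : ∀ x, ∃ y, x ∈ V → ∃ e ∈ M, G.IsLink e x y := by
    intro x
    by_cases hx : x ∈ V
    · obtain ⟨e, he, y, hy⟩ := hM.exists_inc x ((hmem x).1 hx)
      exact ⟨y, fun _ ↦ ⟨e, he, hy⟩⟩
    · exact ⟨x, fun h ↦ absurd h hx⟩
  choose f hf using this
  have hfe : ∀ e ∈ M, ∀ x y, G.IsLink e x y → f x = y := by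
    intro e he x y hxy
    obtain ⟨e', he', h⟩ := hf x ((hmem x).2 hxy.left_mem)
    obtain rfl := hM.disjoint e he e' he' x hxy.inc_left h.inc_left
    exact h.right_unique hxy
  refine ⟨f, fun x hx ↦ ?_, hfe⟩
  obtain ⟨e, he, h⟩ := hf x hx
  refine ⟨(hmem _).2 h.right_mem, ⟨fun hx ↦ hM.not_isLoopAt e he x ?_, h.adj⟩,
    hfe e he _ _ h.symm⟩
  rw [← hx] at h
  exact h

/-- The edge is chosen by unordered pair, so that `x` and `f x` get the same one among parallel
edges; on its own pair `e₀` is imposed. -/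
lemma exists_isPerfectMatching_mem (hV : (V : Set α) = G.vertexSet)
    (hf : G.simplify.IsPairing f V) {e₀ : β} {x₀ : α} (he₀ : G.IsLink e₀ x₀ (f x₀)) :
    ∃ M, G.IsPerfectMatching M ∧ e₀ ∈ M := by
  classical
  have hmem : ∀ x, x ∈ V ↔ x ∈ G.vertexSet := fun x ↦ by rw [← hV, Finset.mem_coe]
  have : ∀ p : Sym2 α, ∃ e : β, ∀ x y, p = s(x, y) → G.Adj x y → G.IsLink e x y := by
    intro p
    induction p using Sym2.ind with | _ x y =>
    by_cases hxy : G.Adj x y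
    · obtain ⟨e, he⟩ := hxy
      refine ⟨e, fun u w huw _ ↦ ?_⟩
      rcases Sym2.eq_iff.1 huw with ⟨rfl, rfl⟩ | ⟨rfl, rfl⟩
      exacts [he, he.symm]
    · refine ⟨e₀, fun u w huw h ↦ absurd ?_ hxy⟩
      rcases Sym2.eq_iff.1 huw with ⟨rfl, rfl⟩ | ⟨rfl, rfl⟩
      exacts [h, h.symm]
  choose ε hε using this
  let ε' : Sym2 α → β := fun p ↦ if p = s(x₀, f x₀) then e₀ else ε p
  have hε' : ∀ x ∈ V, G.IsLink (ε' s(x, f x)) x (f x) := by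
    intro x hx
    by_cases h : s(x, f x) = s(x₀, f x₀)
    · simp only [ε', h, if_true]
      rcases Sym2.eq_iff.1 h with ⟨h1, h2⟩ | ⟨h1, h2⟩
      · rw [h2, h1]
        exact he₀
      · rw [h2, h1]
        exact he₀.symm
    · simp only [ε', h, if_false]
      exact hε _ _ _ rfl (hf x hx).2.1.2
  have hinc : ∀ x ∈ V, ∀ z, G.Inc (ε' s(x, f x)) z → s(x, f x) = s(z, f z) := by
    intro x hx z hz
    rcases hz.eq_or_eq_of_isLink (hε' x hx) with rfl | rfl
    · rfl
    · rw [(hf x hx).2.2, Sym2.eq_swap]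
  refine ⟨{e | ∃ x ∈ V, e = ε' s(x, f x)}, ⟨⟨?_, ?_, ?_⟩, ?_⟩, x₀, (hmem _).2 he₀.left_mem, ?_⟩
  · rintro _ ⟨x, hx, rfl⟩
    exact (hε' x hx).edge_mem
  · rintro _ ⟨x, hx, rfl⟩ z hz
    have h1 := hz.eq_of_inc (hε' x hx).inc_left
    have h2 := hz.eq_of_inc (hε' x hx).inc_right
    exact (hf x hx).2.1.1 (h1.symm.trans h2)
  · rintro _ ⟨x, hx, rfl⟩ _ ⟨y, hy, rfl⟩ z hz hz'
    rw [hinc x hx z hz, hinc y hy z hz']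
  · intro x hx
    have hx := (hmem x).2 hx
    exact ⟨_, ⟨x, hx, rfl⟩, (hε' x hx).inc_left⟩
  · simp [ε']

lemma isFactorizable_iff (hV : (V : Set α) = G.vertexSet) :
    G.IsFactorizable ↔ G.simplify.Matchable V := by
  constructor
  · rintro ⟨M, hM⟩
    obtain ⟨f, hf, -⟩ := hM.exists_isPairing hV
    exact hf.matchable
  · rintro ⟨f, hf⟩
    -- The empty graph has no edge to serve as `e₀`.
    obtain rfl | ⟨x, hx⟩ := V.eq_empty_or_nonempty
    · refine ⟨∅, ⟨by simp, by simp, by simp⟩, fun x hx ↦ ?_⟩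
      simp [← hV] at hx
    · obtain ⟨e, he⟩ := (hf x hx).2.1.2
      obtain ⟨M, hM, -⟩ := exists_isPerfectMatching_mem hV hf he
      exact ⟨M, hM⟩

/-- The map to the vertices of `G[X] / A`. -/
def contractMap (G : Graph α β) (X A : Finset α) : α → Set α :=
  ((G.induce X).restrict ((G.induce X).induce A).edgeSet).reach

lemma contractMap_adj {x y : α}
    (h : ((G.induce X).restrict ((G.induce X).induce A).edgeSet).Adj x y) : x ∈ A ∧ y ∈ A := by
  obtain ⟨e, ⟨u, w, huw, hu, hw⟩, he⟩ := h
  rcases he.eq_and_eq_or_eq_and_eq huw with ⟨rfl, rfl⟩ | ⟨rfl, rfl⟩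
  exacts [⟨hu, hw⟩, ⟨hw, hu⟩]

lemma contractMap_of_notMem {x : α} (hx : x ∉ A) : G.contractMap X A x = {x} := by
  ext z
  constructor
  · intro hz
    rcases ReflTransGen.cases_head hz with rfl | ⟨y, hy, -⟩
    · rfl
    · exact absurd (contractMap_adj hy).1 hx
  · rintro rfl
    exact ReflTransGen.refl

variable [DecidableEq α]

/-- An edge parallel to an allowed one can replace it, so being allowed depends only on the ends. -/
lemma restrict_allowedEdges_adj (hV : (V : Set α) = G.vertexSet) {x y : α} :
    (G.restrict G.allowedEdges).Adj x y ↔ G.simplify.AllowedAdj V x y := by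
  have hmem : ∀ x, x ∈ V ↔ x ∈ G.vertexSet := fun x ↦ by rw [← hV, Finset.mem_coe]
  constructor
  · rintro ⟨e, ⟨M, hM, heM⟩, he⟩
    obtain ⟨f, hf, hfe⟩ := hM.exists_isPairing hV
    rw [← hfe e heM x y he]
    exact hf.allowedAdj ((hmem x).2 he.left_mem)
  · intro h
    obtain ⟨e, he⟩ := h.1.2
    obtain ⟨f, hf, rfl⟩ := h.exists_isPairing
    obtain ⟨M, hM, heM⟩ := exists_isPerfectMatching_mem hV hf he
    exact ⟨e, ⟨M, hM, heM⟩, he⟩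

lemma mem_factorComponents_iff (hV : (V : Set α) = G.vertexSet) {H : Graph α β} :
    H ∈ G.factorComponents ↔ ∃ A, G.simplify.IsFactorClass V A ∧ H = G.induce A := by
  have hmem : ∀ x, x ∈ V ↔ x ∈ G.vertexSet := fun x ↦ by rw [← hV, Finset.mem_coe]
  have hadj : (G.restrict G.allowedEdges).Adj = G.simplify.AllowedAdj V := by
    funext x y
    exact propext (restrict_allowedEdges_adj hV)
  have hreach : ∀ v, (G.restrict G.allowedEdges).reach v =
      {w | ReflTransGen (G.simplify.AllowedAdj V) v w} := by
    intro v
    rw [reach, hadj]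
  constructor
  · rintro ⟨K, ⟨v, hv, rfl⟩, rfl⟩
    classical
    have hv : v ∈ V := (hmem v).2 hv
    have hA : ∀ z, z ∈ V.filter (ReflTransGen (G.simplify.AllowedAdj V) v) ↔
        ReflTransGen (G.simplify.AllowedAdj V) v z := by
      intro z
      rw [Finset.mem_filter, and_iff_right_iff_imp]
      intro h
      cases h with
      | refl => exact hv
      | tail _ h => exact h.2.2.1
    refine ⟨V.filter (ReflTransGen (G.simplify.AllowedAdj V) v), ⟨v, hv, hA⟩, ?_⟩
    congr 1
    ext z
    rw [Finset.mem_coe, hA]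
    change z ∈ (G.restrict G.allowedEdges).reach v ↔ _
    rw [hreach]
    rfl
  · rintro ⟨A, ⟨v, hv, hA⟩, rfl⟩
    refine ⟨_, ⟨v, (hmem v).1 hv, rfl⟩, ?_⟩
    congr 1
    ext z
    change _ ↔ z ∈ (G.restrict G.allowedEdges).reach v
    rw [hreach, Finset.mem_coe, hA]
    rfl

lemma isSeparating_iff (hV : (V : Set α) = G.vertexSet) :
    G.IsSeparating X ↔ G.simplify.IsAllowedClosed V X := by
  classical
  constructor
  · rintro ⟨hX, h⟩
    rw [← hV, Finset.coe_subset] at hX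
    refine ⟨hX, fun x hx y hxy ↦ ?_⟩
    let A := V.filter (ReflTransGen (G.simplify.AllowedAdj V) x)
    have hA : ∀ z, z ∈ A ↔ ReflTransGen (G.simplify.AllowedAdj V) x z := by
      intro z
      rw [Finset.mem_filter, and_iff_right_iff_imp]
      intro h
      cases h with
      | refl => exact hX hx
      | tail _ h => exact h.2.2.1
    rcases h (G.induce A) ((mem_factorComponents_iff hV).2 ⟨A, ⟨x, hX hx, hA⟩, rfl⟩) with h | h
    · exact h ((hA y).2 (.single hxy))
    · have : x ∈ (A : Set α) ∩ X := ⟨(hA x).2 .refl, hx⟩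
      exact absurd (h ▸ this) (Set.notMem_empty x)
  · intro hX
    refine ⟨by rw [← hV, Finset.coe_subset]; exact hX.1, fun H hH ↦ ?_⟩
    obtain ⟨A, hA, rfl⟩ := (mem_factorComponents_iff hV).1 hH
    by_cases h : ∃ x ∈ A, x ∈ X
    · obtain ⟨x, hxA, hxX⟩ := h
      exact Or.inl (Finset.coe_subset.2 (hA.subset_of_mem hX hxA hxX))
    · refine Or.inr (Set.eq_empty_of_forall_notMem fun x hx ↦ h ⟨x, hx.1, hx.2⟩)

/-- Allowed edges connect `A` within itself, so the contraction makes it a single vertex. -/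
lemma contractMap_of_mem (hA : G.simplify.IsFactorClass V A) (hAX : A ⊆ X) {x : α} (hx : x ∈ A) :
    G.contractMap X A x = A := by
  ext z
  constructor
  · intro hz
    induction (hz : ReflTransGen _ x z) with
    | refl => exact hx
    | tail _ h _ => exact (contractMap_adj h).2
  · intro hz
    have := (hA.reflTransGen hx).1 (Finset.mem_coe.1 hz)
    clear hz
    change ReflTransGen _ x z
    induction this with
    | refl => exact .refl
    | @tail u w huu huw ih =>
      have hu := (hA.reflTransGen hx).2 huu
      have hw := hA.isAllowedClosed.2 u hu w huw
      obtain ⟨e, he⟩ := huw.1.2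
      exact ih.tail ⟨e, ⟨u, w, ⟨he, hAX hu, hAX hw⟩, hu, hw⟩, he, hAX hu, hAX hw⟩

lemma contractMap_eq_iff (hA : G.simplify.IsFactorClass V A) (hAX : A ⊆ X) {x y : α} :
    G.contractMap X A x = G.contractMap X A y ↔ x = y ∨ x ∈ A ∧ y ∈ A := by
  by_cases hx : x ∈ A <;> by_cases hy : y ∈ A
  · simp [contractMap_of_mem hA hAX, hx, hy]
  · rw [contractMap_of_mem hA hAX hx, contractMap_of_notMem hy]
    refine ⟨fun h ↦ absurd ?_ hy, by rintro (rfl | h); exacts [absurd hx hy, absurd h.2 hy]⟩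
    rw [← Finset.mem_coe, h]
    rfl
  · rw [contractMap_of_mem hA hAX hy, contractMap_of_notMem hx]
    refine ⟨fun h ↦ absurd ?_ hx, by rintro (rfl | h); exacts [absurd hy hx, absurd h.1 hx]⟩
    rw [← Finset.mem_coe, ← h]
    rfl
  · simp [contractMap_of_notMem, hx, hy]

lemma simplify_contractVerts_adj (hA : G.simplify.IsFactorClass V A) (hAX : A ⊆ X)
    {D P Q : Set α} :
    (((G.induce X).contractVerts A).deleteVerts {D}).simplify.Adj P Q ↔ P ≠ Q ∧ P ≠ D ∧ Q ≠ D ∧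
      ∃ x ∈ X, ∃ y ∈ X, G.Adj x y ∧ G.contractMap X A x = P ∧ G.contractMap X A y = Q := by
  constructor
  · rintro ⟨hPQ, e, he⟩
    rw [deleteVerts_isLink] at he
    obtain ⟨⟨x, y, ⟨⟨he, hx, hy⟩, -⟩, h1, h2⟩, hP, hQ⟩ := he
    exact ⟨hPQ, hP, hQ, x, hx, y, hy, he.adj, h1, h2⟩
  · rintro ⟨hPQ, hP, hQ, x, hx, y, hy, ⟨e, he⟩, rfl, rfl⟩
    refine ⟨hPQ, e, ?_⟩
    rw [deleteVerts_isLink]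
    refine ⟨⟨x, y, ⟨⟨he, hx, hy⟩, ?_⟩, rfl, rfl⟩, hP, hQ⟩
    intro heF
    have : ((G.induce X).restrict ((G.induce X).induce A).edgeSet).Adj x y :=
      ⟨e, heF, he, hx, hy⟩
    exact hPQ ((contractMap_eq_iff hA hAX).2 (Or.inr (contractMap_adj this)))

/-- A pairing on a set of representatives of the vertices other than `D` of the contraction. -/
lemma isFactorizable_contractVerts_deleteVerts (hA : G.simplify.IsFactorClass V A) (hAX : A ⊆ X)
    {Z : Finset α} {D : Set α} (hZX : Z ⊆ X) (hr : Set.InjOn (G.contractMap X A) Z)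
    (hZ : ∀ x ∈ X, G.contractMap X A x ≠ D ↔
      ∃ z ∈ Z, G.contractMap X A z = G.contractMap X A x) (hm : G.simplify.Matchable Z) :
    (((G.induce X).contractVerts A).deleteVerts {D}).IsFactorizable := by
  classical
  obtain ⟨g, hg⟩ := hm
  have hD : ∀ z ∈ Z, G.contractMap X A z ≠ D := fun z hz ↦ (hZ z (hZX hz)).2 ⟨z, hz, rfl⟩
  have hT : ∀ p, p ∈ Z.image (G.contractMap X A) ↔ ∃ z ∈ Z, G.contractMap X A z = p := fun p ↦
    Finset.mem_image
  refine (isFactorizable_iff (V := Z.image (G.contractMap X A)) ?_).2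
    (hg.matchable_image hr hT fun z hz ↦ ?_)
  · ext p
    rw [Finset.mem_coe, hT]
    constructor
    · rintro ⟨z, hz, rfl⟩
      exact ⟨⟨z, hZX hz, rfl⟩, hD z hz⟩
    · rintro ⟨⟨x, hx, rfl⟩, hpD⟩
      exact (hZ x hx).1 hpD
  · obtain ⟨h1, h2, -⟩ := hg z hz
    exact (simplify_contractVerts_adj hA hAX).2 ⟨fun h ↦ h2.1 (hr hz h1 h), hD z hz, hD _ h1,
      z, hZX hz, g z, hZX h1, h2.2, rfl, rfl⟩

/-- Deleting the contracted vertex leaves `X \ A`, which `f` matches. If another vertex `v` is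
deleted, the matching edge at the contracted vertex comes from some `y ∈ A`, and `y` can stand for
that vertex. -/
lemma isFactorCritical_contractVerts_iff (hf : G.simplify.IsPairing f V)
    (hX : G.simplify.IsAllowedClosed V X) (hA : G.simplify.IsFactorClass V A) (hAX : A ⊆ X) :
    ((G.induce X).contractVerts A).IsFactorCritical ↔ G.simplify.IsCriticalOver X A := by
  classical
  have heq : ∀ x y, G.contractMap X A x = G.contractMap X A y ↔ x = y ∨ x ∈ A ∧ y ∈ A :=
    fun x y ↦ contractMap_eq_iff hA hAX
  have hrep : ∀ v ∈ X \ A, ∀ y ∈ A,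
      Set.InjOn (G.contractMap X A) (insert y ((X \ A).erase v) : Finset α) ∧
      ∀ x ∈ X, G.contractMap X A x ≠ G.contractMap X A v ↔ ∃ z ∈ insert y ((X \ A).erase v),
        G.contractMap X A z = G.contractMap X A x := by
    intro v hv y hy
    rw [Finset.mem_sdiff] at hv
    refine ⟨fun a ha b hb hab ↦ ?_, fun x hx ↦ ?_⟩
    · rw [heq] at hab
      rw [Finset.mem_coe] at ha hb
      grind
    · rw [Ne, heq]
      constructor
      · intro h
        by_cases hxA : x ∈ A
        · exact ⟨y, by simp, (heq _ _).2 (Or.inr ⟨hy, hxA⟩)⟩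
        · exact ⟨x, by grind, rfl⟩
      · rintro ⟨z, hz, hzx⟩
        rw [heq] at hzx
        grind
  constructor
  · intro h v hv
    have hv' := Finset.mem_sdiff.1 hv
    have hm := h (G.contractMap X A v) ⟨v, hv'.1, rfl⟩
    obtain ⟨a, ha⟩ := hA.nonempty
    have hT : ∀ y ∈ A, ∀ p, p ∈ (X.image (G.contractMap X A)).erase (G.contractMap X A v) ↔
        ∃ z ∈ insert y ((X \ A).erase v), G.contractMap X A z = p := by
      intro y hy p
      rw [Finset.mem_erase, Finset.mem_image]
      constructor
      · rintro ⟨h1, x, hx, rfl⟩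
        exact ((hrep v hv y hy).2 x hx).1 h1
      · rintro ⟨z, hz, rfl⟩
        have hzX : z ∈ X := by
          have := hAX hy
          grind
        exact ⟨((hrep v hv y hy).2 z hzX).2 ⟨z, hz, rfl⟩, z, hzX, rfl⟩
    rw [isFactorizable_iff (V := (X.image (G.contractMap X A)).erase (G.contractMap X A v)) (by
      rw [Finset.coe_erase, Finset.coe_image]
      rfl)] at hm
    obtain ⟨h, hh⟩ := hm
    obtain ⟨h1, h2, h3⟩ := hh _ ((hT a ha _).2 ⟨a, by simp, rfl⟩)
    obtain ⟨-, -, -, y, hyX, x, hxX, hyx, hya, hxa⟩ := (simplify_contractVerts_adj hA hAX).1 h2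
    rw [heq] at hya
    have hy : y ∈ A := by grind
    have hya : G.contractMap X A a = G.contractMap X A y := (heq _ _).2 (Or.inr ⟨ha, hy⟩)
    rw [hya] at hxa h2 h3
    have hxA : x ∉ A := fun hx ↦ h2.ne (hxa ▸ (heq _ _).2 (Or.inr ⟨hy, hx⟩))
    -- The representative of `A` is the end `y` of an edge to the partner `x` of the contracted
    -- vertex; a matched pair that involves `y` must therefore be `y` and `x`.
    refine ⟨y, hy, Matchable.of_injOn hh (hrep v hv y hy).1 (hT y hy) fun z hz w hw hzw hhzw ↦ ?_⟩
    obtain ⟨hne, -, -, u, huX, t, htX, hut, huz, htw⟩ := (simplify_contractVerts_adj hA hAX).1 hzw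
    refine ⟨fun h ↦ hne (h ▸ rfl), ?_⟩
    rw [heq] at huz htw
    by_cases hzA : z ∈ A
    · obtain rfl : z = y := by grind
      rw [← hxa, heq] at hhzw
      obtain rfl : x = w := by grind
      exact hyx
    by_cases hwA : w ∈ A
    · obtain rfl : w = y := by grind
      have h4 := (hh _ ((hT a ha _).2 ⟨z, by grind, rfl⟩)).2.2
      rw [hhzw, ← hxa, heq] at h4
      obtain rfl : x = z := by grind
      exact hyx.symm
    · obtain rfl : u = z := by grind
      obtain rfl : t = w := by grind
      exact hut
  · rintro h _ ⟨v, hvX, rfl⟩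
    change α at v
    by_cases hv : v ∈ A
    · refine isFactorizable_contractVerts_deleteVerts hA hAX (Z := X \ A) Finset.sdiff_subset ?_ ?_
        (hf.sdiff hX hA.isAllowedClosed).matchable
      · intro a ha b hb hab
        have hab := (heq a b).1 hab
        rw [Finset.mem_coe] at ha hb
        grind
      · intro x hx
        refine (heq x v).not.trans ?_
        constructor
        · exact fun h ↦ ⟨x, by grind, rfl⟩
        · rintro ⟨z, hz, hzx⟩
          rw [heq] at hzx
          grind
    · have hv' : v ∈ X \ A := Finset.mem_sdiff.2 ⟨hvX, hv⟩
      obtain ⟨y, hy, hm⟩ := h v hv'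
      refine isFactorizable_contractVerts_deleteVerts hA hAX ?_ (hrep v hv' y hy).1
        (hrep v hv' y hy).2 hm
      have := hAX hy
      grind

lemma yields_iff (hV : (V : Set α) = G.vertexSet) (hf : G.simplify.IsPairing f V)
    {G₁ G₂ : G.factorComponents} {B : Finset α} (hA : G.simplify.IsFactorClass V A)
    (hG₁ : (G₁ : Graph α β) = G.induce A) (hG₂ : (G₂ : Graph α β) = G.induce B) :
    G.Yields G₁ G₂ ↔ ∃ X, G.simplify.IsAllowedClosed V X ∧ A ⊆ X ∧ B ⊆ X ∧
      G.simplify.IsCriticalOver X A := by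
  rw [Yields, hG₁, hG₂]
  constructor
  · rintro ⟨X, hX, hABX, hc⟩
    have hXV : X ⊆ V := hV ▸ hX.1
    obtain ⟨X, rfl⟩ : ∃ Y : Finset α, (Y : Set α) = X :=
      ⟨(V.finite_toSet.subset hXV).toFinset, by simp⟩
    rw [isSeparating_iff hV] at hX
    have hAX : A ⊆ X := Finset.coe_subset.1 (Set.subset_union_left.trans hABX)
    exact ⟨X, hX, hAX, Finset.coe_subset.1 (Set.subset_union_right.trans hABX),
      (isFactorCritical_contractVerts_iff hf hX hA hAX).1 hc⟩
  · rintro ⟨X, hX, hAX, hBX, hc⟩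
    exact ⟨X, (isSeparating_iff hV).2 hX,
      Set.union_subset (Finset.coe_subset.2 hAX) (Finset.coe_subset.2 hBX),
      (isFactorCritical_contractVerts_iff hf hX hA hAX).2 hc⟩

end Graph

theorem mainTheorem1 {α β : Type*} (G : Graph α β) (hV : G.vertexSet.Finite)
    (hG : G.IsFactorizable) : IsPartialOrder G.factorComponents G.Yields := by
  classical
  obtain ⟨V, hVG⟩ : ∃ V : Finset α, (V : Set α) = G.vertexSet := ⟨hV.toFinset, by simp⟩
  obtain ⟨f, hf⟩ := (Graph.isFactorizable_iff hVG).1 hG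
  have hcl : ∀ H : G.factorComponents, ∃ A, G.simplify.IsFactorClass V A ∧
      (H : Graph α β) = G.induce A := fun H ↦ (Graph.mem_factorComponents_iff hVG).1 H.2
  refine { refl := fun H ↦ ?_, trans := fun H₁ H₂ H₃ h₁₂ h₂₃ ↦ ?_,
           antisymm := fun H₁ H₂ h₁₂ h₂₁ ↦ ?_ }
  · obtain ⟨A, hA, hHA⟩ := hcl H
    rw [Graph.yields_iff hVG hf hA hHA hHA]
    exact ⟨A, hA.isAllowedClosed, subset_rfl, subset_rfl, fun v hv ↦ by simp at hv⟩
  · obtain ⟨A, hA, hHA⟩ := hcl H₁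
    obtain ⟨B, hB, hHB⟩ := hcl H₂
    obtain ⟨C, hC, hHC⟩ := hcl H₃
    rw [Graph.yields_iff hVG hf hA hHA hHB] at h₁₂
    rw [Graph.yields_iff hVG hf hB hHB hHC] at h₂₃
    rw [Graph.yields_iff hVG hf hA hHA hHC]
    obtain ⟨X, hX, hAX, hBX, hXA⟩ := h₁₂
    obtain ⟨Y, hY, hBY, hCY, hYB⟩ := h₂₃
    exact ⟨X ∪ Y, hX.union hY, hAX.trans Finset.subset_union_left,
      hCY.trans Finset.subset_union_right,
      hXA.trans hf hX hY hA.isAllowedClosed hAX hBX hBY hYB⟩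
  · obtain ⟨A, hA, hHA⟩ := hcl H₁
    obtain ⟨B, hB, hHB⟩ := hcl H₂
    rw [Graph.yields_iff hVG hf hA hHA hHB] at h₁₂
    rw [Graph.yields_iff hVG hf hB hHB hHA] at h₂₁
    obtain ⟨X, hX, hAX, hBX, hXA⟩ := h₁₂
    obtain ⟨Y, hY, hBY, hAY, hYB⟩ := h₂₁
    have := hA.eq_of_isCriticalOver hf hB hX hY hBX hAY hXA hYB
    exact Subtype.ext (by rw [hHA, hHB, this])
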